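/- Let $V$ be a finite non-empty set, $n=|V|$, and let $f:2^V\to\mathbb{Z}$ be submodular with $f(\emptyset)=0$, given by an evaluation oracle that returns $f(S)$ in time $\mathrm{EO}\ge 0$. Let $B(f)=\{x\in\mathbb{R}^V: x(S)\le f(S)\ \forall S\subseteq V,\ x(V)=f(V)\}$ and $L_{f,2}=\max\{\|z\|_2: z\in B(f)\}$. For $\mu\in\mathbb{R}$ let $f_\mu(\emptyset)=f_\mu(V)=0$ and $f_\mu(S)=f(S)+\mu$ otherwise. The extreme base of $B(f_\mu)$ defined by an ordering $v_1,\dots,v_n$ of $V$ is the vector $g$ with $g(v_i)=f_\mu(\{v_1,\dots,v_i\})-f_\mu(\{v_1,\dots,v_{i-1}\})$. For a symmetric positive definite matrix $Q$ let $\langle x,y\rangle_Q=x^{\mathsf T}Qy$ and $\|x\|_Q=\sqrt{\langle x,x\rangle_Q}$, and read $g/\|g\|_Q$ as $0$ if $g=0$. **Sliding von Neumann** (input $\mu,W,Q,\varepsilon$). Let $g_1$ be the extreme base of $B(f_\mu)$ defined by an arbitrary ordering, $x_1:=1$, $y:=g_1/\|g_1\|_Q$. For $k=2,3,\dots$, while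 $\|y\|_Q>\varepsilon$: order $V$ so that the weights $w=Qy$ are ascending, $w(v_1)\le\dots\le w(v_n)$, and let $g_k$ be the extreme base of $B(f_\mu)$ defined by this ordering. If $\langle y,g_k\rangle_Q>0$, then let $W$ be a minimizer of $f_\mu$ among the sets $\{v_1,\dots,v_i\}$, $1\le i\le n$, put $\delta:=-f_\mu(W)$, then $\mu:=-f(W)$, and add $\delta$ to $g_k(v_1)$ and subtract $\delta$ from $g_k(v_n)$. Let $h=g_k/\|g_k\|_Q$ and $\lambda=\langle y-h,y\rangle_Q/\|y-h\|_Q^2$, and set $y:=(1-\lambda)y+\lambda h$, $x_i:=(1-\lambda)x_i$ for $i<k$, and $x_k:=\lambda$. Return $\mu$, $W$, the $g_i$ and $x_i$, and $y$. **Rescaling-SFM.** Let $\varepsilon=\frac1{20n}$ and $T=\lceil 5n\log_2(nL_{f,2})\rceil$ ($T=0$ if $L_{f,2}=0$). Start with $Q=R=I_n$, $\mu=\max\{0,-f(V)\}$, and $W=V$ if $f(V)<0$, $W=\emptyset$ otherwise. Repeat $T$ times: run Sliding von Neumann with the current $\mu,W,Q$ and with $\varepsilon$, to obtain new $\mu,W$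 and $g_i,x_i,y$; if $y=0$, stop and return $W$; otherwise set $$R:=\frac1{(1+\varepsilon)^2}\Bigl(R+\sum_i\frac{x_i}{\|g_i\|_Q^2}\,g_ig_i^{\mathsf T}\Bigr),\qquad Q:=R^{-1}.$$ After $T$ rounds return $W$. **Theorem 3.1.** For every such $f$, and however the arbitrary choices are made (starting orderings, ties in the orderings, ties between minimizing sets $W$), Rescaling-SFM terminates and returns a set $W$ with $f(W)=\min_{S\subseteq V}f(S)$. Its running time is $$O\bigl((n^4\cdot\mathrm{EO}+n^5)\log(nL_{f,2})\bigr),$$ with an absolute implied constant, where $\log(nL_{f,2})$ is to be read as $\log\max\{2,nL_{f,2}\}$. Time is counted as $\mathrm{EO}$ for each oracle call and $1$ for each elementary operation (exact real arithmetic, square roots, comparisons, storing a number). The number $T$ is part of the input here. The same two assertions, with the same bound, hold for the variant that does not know $L_{f,2}$ but first computes $\|\alpha\|_2$, where $\alpha(v)=\max\{|f(\{v\})|,|f(V)-f(V\setminus\{v\})|\}$, and uses $T=\lceil 5n\log_2(n\|\alpha\|_2)\rceil$ (again $T=0$ if $\|\alpha\|_2=0$; the logarithm and the rounding count as elementary operations).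 -/

import Mathlib

/-! Submodular functions, the base polytope, and the rescaling algorithm for submodular function
minimization, written as a program with an explicit count of oracle calls and elementary
operations. -/

noncomputable section

namespace SFM

/-! ### Submodular functions -/

section Functions

variable {V : Type} [Fintype V] [DecidableEq V]

/-- Submodularity of an integer-valued set function. -/
def IsSubmodular (f : Finset V → ℤ) : Prop :=
  ∀ X Y : Finset V, f (X ∩ Y) + f (X ∪ Y) ≤ f X + f Y

/-- The Euclidean norm of a vector indexed by `V`. -/
def norm2 (x : V → ℝ) : ℝ := √(∑ v, x v ^ 2)

/-- The base polytope `B(f) = {x : x(S) ≤ f(S) for all S ⊆ V, x(V) = f(V)}`. -/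
def basePolytope (f : Finset V → ℤ) : Set (V → ℝ) :=
  {x | (∀ S : Finset V, ∑ v ∈ S, x v ≤ (f S : ℝ)) ∧ ∑ v, x v = (f Finset.univ : ℝ)}

/-- `L_{f,2}`, the maximum Euclidean norm of a base (for submodular `f` with `f ∅ = 0` the base
polytope is compact and non-empty, so that the supremum is attained). -/
def maxNorm (f : Finset V → ℤ) : ℝ := sSup (norm2 '' basePolytope f)

/-- The number of rescalings belonging to the value `Z` of the complexity parameter:
`5 n log₂ (n Z)`, rounded up. -/
def numRescalings (n : ℕ) (Z : ℝ) : ℕ := ⌈5 * (n : ℝ) * Real.logb 2 ((n : ℝ) * Z)⌉₊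

end Functions

/-! ### Cost model -/

/-- The result of a computation together with the number of calls to the evaluation oracle and the
number of elementary operations it has performed. -/
structure Timed (α : Type) where
  /-- the result -/
  val : α
  /-- number of calls to the evaluation oracle -/
  calls : ℕ
  /-- number of elementary operations -/
  ops : ℕ

namespace Timed

instance : Monad Timed where
  pure a := ⟨a, 0, 0⟩
  bind x g := ⟨(g x.val).val, x.calls + (g x.val).calls, x.ops + (g x.val).ops⟩

/-- Running time, when a call to the evaluation oracle takes time `EO` and an elementary operation
takes time `1`. -/
def time {α : Type} (EO : ℝ) (x : Timed α) : ℝ := x.calls * EO + x.ops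

/-- Charge `k` elementary operations. -/
def charge (k : ℕ) : Timed Unit := ⟨(), 0, k⟩

/-- Ask the evaluation oracle for the value `f S`. -/
def query {V : Type} (f : Finset V → ℤ) (S : Finset V) : Timed ℝ := ⟨(f S : ℝ), 1, 0⟩

/-! The elementary operations are exact real arithmetic (with square roots) and comparison. -/

/-- addition -/
def add (a b : ℝ) : Timed ℝ := ⟨a + b, 0, 1⟩
/-- subtraction -/
def sub (a b : ℝ) : Timed ℝ := ⟨a - b, 0, 1⟩
/-- multiplication -/
def mul (a b : ℝ) : Timed ℝ := ⟨a * b, 0, 1⟩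
/-- division; `a / 0` is `0` -/
def div (a b : ℝ) : Timed ℝ := ⟨a / b, 0, 1⟩
/-- square root -/
def sqrt (a : ℝ) : Timed ℝ := ⟨√a, 0, 1⟩
/-- absolute value -/
def abs (a : ℝ) : Timed ℝ := ⟨|a|, 0, 1⟩

open Classical in
/-- the test `a < b` -/
def lt (a b : ℝ) : Timed Bool := ⟨decide (a < b), 0, 1⟩

open Classical in
/-- the test `a ≤ b` -/
def le (a b : ℝ) : Timed Bool := ⟨decide (a ≤ b), 0, 1⟩

variable {V : Type} [Fintype V] [DecidableEq V]

/-- Compute the entries of a vector one after the other, and store each of them. -/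
def vec (g : V → Timed ℝ) : Timed (V → ℝ) :=
  ⟨fun v => (g v).val, ∑ v, (g v).calls, ∑ v, ((g v).ops + 1)⟩

/-- Compute the entries of a matrix one after the other, and store each of them. -/
def mat (g : V → V → Timed ℝ) : Timed (Matrix V V ℝ) :=
  ⟨Matrix.of fun u v => (g u v).val, ∑ u, ∑ v, (g u v).calls, ∑ u, ∑ v, ((g u v).ops + 1)⟩

/-- Compute numbers one after the other, and add each of them to an accumulator. -/
def sum (g : V → Timed ℝ) : Timed ℝ :=
  ⟨∑ v, (g v).val, ∑ v, (g v).calls, ∑ v, ((g v).ops + 1)⟩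

/-- The standard scalar product. -/
def dot (x y : V → ℝ) : Timed ℝ := sum fun v => mul (x v) (y v)

/-- The matrix-vector product. -/
def mulVec (Q : Matrix V V ℝ) (y : V → ℝ) : Timed (V → ℝ) :=
  vec fun u => sum fun v => mul (Q u v) (y v)

/-- The scalar product `xᵀ Q y`. -/
def innerQ (Q : Matrix V V ℝ) (x y : V → ℝ) : Timed ℝ := do
  let w ← mulVec Q y
  dot x w

/-- The norm `√(xᵀ Q x)`. -/
def normQ (Q : Matrix V V ℝ) (x : V → ℝ) : Timed ℝ := do
  let s ← innerQ Q x x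
  sqrt s

/-- The normalized vector `x / ‖x‖_Q`; the zero vector is left unchanged. -/
def normalize (Q : Matrix V V ℝ) (x : V → ℝ) : Timed (V → ℝ) := do
  let s ← normQ Q x
  vec fun v => div (x v) s

open Classical in
/-- The test whether a vector is zero, at the price of one comparison for each entry. -/
def isZero (y : V → ℝ) : Timed Bool := ⟨decide (y = 0), 0, Fintype.card V⟩

/-- One pivot step of Gauss-Jordan elimination for the inversion of `R`: `B`, the product of the
elementary matrices so far, is multiplied from the left by the elementary matrix that turns
column `j` of `B R` into the `j`-th unit vector. -/
def pivot (R B : Matrix V V ℝ) (j : V) : Timed (Matrix V V ℝ) := do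
  let d ← mulVec B (fun u => R u j)
  let r ← vec fun v => div (B j v) (d j)
  mat fun u v =>
    if u = j then pure (r v)
    else do
      let t ← mul (d u) (r v)
      sub (B u v) t

/-- Pivot steps for all the columns in a list. -/
def pivots (R : Matrix V V ℝ) : List V → Matrix V V ℝ → Timed (Matrix V V ℝ)
  | [], B => pure B
  | j :: l, B => do
    let B' ← pivot R B j
    pivots R l B'

/-- The identity matrix. -/
def identity : Timed (Matrix V V ℝ) := mat fun u v => pure (if u = v then 1 else 0)

/-- The inverse of a symmetric positive definite matrix, by Gauss-Jordan elimination (the pivots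
of such a matrix are positive). -/
def inverse (R : Matrix V V ℝ) : Timed (Matrix V V ℝ) := do
  let B ← identity
  pivots R Finset.univ.toList B

end Timed

open Timed

/-! ### The algorithm -/

section Algorithm

variable {V : Type} [Fintype V] [DecidableEq V]

/-- The algorithm leaves open which extreme base the `i`-th call of the sliding von Neumann
algorithm starts from, how ties are broken when the elements of `V` are sorted by weight, and which
of several minimizing prefixes is taken. All of these are inputs here: `order i 0` is the order that
defines the first base of call `i`, `order i k` for `k ≥ 1` lists the elements such that ties in the
`k`-th iteration are broken in favour of the element that comes first, and if a prefix `S` ties with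
the best of the shorter ones, then `prefer i k S` tells whether to take `S` instead. -/
structure Choices (V : Type) where
  order : ℕ → ℕ → List V
  order_nodup : ∀ i k, (order i k).Nodup
  mem_order : ∀ i k v, v ∈ order i k
  prefer : ℕ → ℕ → Finset V → Bool

/-- The value `f_μ(S)` of the sliding function: `0` if `S = ∅` or `S = V`, and `f(S) + μ`
otherwise. The two comparisons of sets are charged one operation for each element. -/
def evalSlide (f : Finset V → ℤ) (μ : ℝ) (S : Finset V) : Timed ℝ := do
  charge (2 * Fintype.card V)
  if S = ∅ ∨ S = Finset.univ then pure 0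
  else do
    let a ← query f S
    add a μ

/-- Insertion of `v` into a list sorted by the weight `w`, before the elements of equal weight. -/
def insertBy (w : V → ℝ) (v : V) : List V → Timed (List V)
  | [] => do
    charge 1
    pure [v]
  | u :: l => do
    charge 1
    if ← le (w v) (w u) then pure (v :: u :: l)
    else do
      let l' ← insertBy w v l
      pure (u :: l')

/-- Stable sorting in ascending order of the weight `w`. -/
def sortBy (w : V → ℝ) : List V → Timed (List V)
  | [] => pure []
  | v :: l => do
    let l' ← sortBy w l
    insertBy w v l'

/-- The remaining part of the greedy algorithm: `l` are the elements still to be processed, `P` the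
set of those already processed, `p = f_μ(P)`, and `x` holds the entries found so far. -/
def greedyAux (f : Finset V → ℤ) (μ : ℝ) :
    List V → Finset V → ℝ → (V → ℝ) → Timed (V → ℝ)
  | [], _, _, x => pure x
  | v :: l, P, p, x => do
    charge 2
    let q ← evalSlide f μ (insert v P)
    let d ← sub q p
    greedyAux f μ l (insert v P) q (Function.update x v d)

/-- The extreme base of `B(f_μ)` defined by the order `v₁, …, vₙ` of `V`, that is,
`x(v_i) = f_μ({v₁, …, v_i}) - f_μ({v₁, …, v_{i-1}})`. For an order with ascending weights it is the
output of the greedy algorithm. -/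
def extremeBase (f : Finset V → ℤ) (μ : ℝ) (l : List V) : Timed (V → ℝ) :=
  greedyAux f μ l ∅ 0 0

/-- The remaining part of the search for a minimizing prefix: `l` are the elements still to be
processed, `P` the set of those already processed, and `S` the best prefix so far, with value
`m = f_μ(S)`. -/
def minPrefixAux (f : Finset V → ℤ) (μ : ℝ) (prefer : Finset V → Bool) :
    List V → Finset V → Finset V → ℝ → Timed (Finset V)
  | [], _, S, _ => pure S
  | v :: l, P, S, m => do
    charge 2
    let q ← evalSlide f μ (insert v P)
    let better ← if prefer (insert v P) then le q m else lt q m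
    if better then minPrefixAux f μ prefer l (insert v P) (insert v P) q
    else minPrefixAux f μ prefer l (insert v P) S m

/-- A set that minimizes `f_μ` among the prefixes `{v₁, …, v_i}`, `1 ≤ i ≤ n`, of an order. -/
def minPrefix (f : Finset V → ℤ) (μ : ℝ) (prefer : Finset V → Bool) :
    List V → Timed (Finset V)
  | [] => pure ∅
  | v :: l => do
    charge 2
    let q ← evalSlide f μ {v}
    minPrefixAux f μ prefer l {v} {v} q

/-- The variables of the sliding von Neumann algorithm: the value `μ`, the set `W`, the list of the
pairs `(x_i, g_i)`, latest first, and the vector `y`. -/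
structure VNState (V : Type) where
  μ : ℝ
  W : Finset V
  gs : List (ℝ × (V → ℝ))
  y : V → ℝ

/-- Multiply all the coefficients `x_i` by `c`. -/
def scaleCoeffs (c : ℝ) : List (ℝ × (V → ℝ)) → Timed (List (ℝ × (V → ℝ)))
  | [] => pure []
  | p :: l => do
    let a ← mul c p.1
    let l' ← scaleCoeffs c l
    pure ((a, p.2) :: l')

/-- Add `δ` to the first entry, in the given order, of the vector `g`, and then subtract `δ` from
the last one. -/
def slideBase (l : List V) (δ : ℝ) (g : V → ℝ) : Timed (V → ℝ) :=
  match l.head?, l.getLast? with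
  | some v₁, some vₙ => do
    charge (Fintype.card V)
    let a ← add (g v₁) δ
    let g₁ := Function.update g v₁ a
    let b ← sub (g₁ vₙ) δ
    pure (Function.update g₁ vₙ b)
  | _, _ => pure g

/-- The choice of `g_k`: apply the greedy algorithm to `f_μ` and the weight `Q y`, and if the base
`g` that it returns satisfies `yᵀ Q g > 0`, then slide. The result is the new value of `μ`, the new
set `W`, and `g_k`. -/
def nextBase (f : Finset V → ℤ) (order : List V) (prefer : Finset V → Bool)
    (Q : Matrix V V ℝ) (s : VNState V) : Timed (ℝ × Finset V × (V → ℝ)) := do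
  let w ← mulVec Q s.y
  let l ← sortBy w order
  let g ← extremeBase f s.μ l
  let c ← dot w g
  if ← lt 0 c then do
    let W ← minPrefix f s.μ prefer l
    let m ← evalSlide f s.μ W
    let δ ← sub 0 m
    let a ← query f W
    let μ ← sub 0 a
    let g' ← slideBase l δ g
    pure (μ, W, g')
  else pure (s.μ, s.W, g)

/-- One iteration of the sliding von Neumann algorithm: find `g_k`, and replace `y` by the point of
minimum `Q`-norm on the segment from `y` to `g_k / ‖g_k‖_Q`. -/
def vnStep (f : Finset V → ℤ) (order : List V) (prefer : Finset V → Bool)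
    (Q : Matrix V V ℝ) (s : VNState V) : Timed (VNState V) := do
  let (μ, W, g) ← nextBase f order prefer Q s
  let h ← normalize Q g
  let d ← vec fun v => sub (s.y v) (h v)
  let a ← innerQ Q d s.y
  let b ← innerQ Q d d
  let t ← div a b
  let t' ← sub 1 t
  let y ← vec fun v => do
    let p ← mul t' (s.y v)
    let q ← mul t (h v)
    add p q
  let gs ← scaleCoeffs t' s.gs
  charge 1
  pure ⟨μ, W, (t, g) :: gs, y⟩

/-- The loop `while ‖y‖_Q > ε` of the sliding von Neumann algorithm, in its `k`-th iteration. The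
result is `none` if the condition has been tested `N` times and the loop has not ended. -/
def vnLoop (f : Finset V → ℤ) (order : ℕ → List V) (prefer : ℕ → Finset V → Bool)
    (Q : Matrix V V ℝ) (ε : ℝ) : ℕ → ℕ → VNState V → Timed (Option (VNState V))
  | 0, _, _ => pure none
  | N + 1, k, s => do
    charge 1
    let r ← normQ Q s.y
    if ← lt ε r then do
      let s' ← vnStep f (order k) (prefer k) Q s
      vnLoop f order prefer Q ε N (k + 1) s'
    else pure (some s)

/-- The sliding von Neumann algorithm. -/
def slidingVonNeumann (f : Finset V → ℤ) (order : ℕ → List V) (prefer : ℕ → Finset V → Bool)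
    (N : ℕ) (μ : ℝ) (W : Finset V) (Q : Matrix V V ℝ) (ε : ℝ) :
    Timed (Option (VNState V)) := do
  let g ← extremeBase f μ (order 0)
  let y ← normalize Q g
  vnLoop f order prefer Q ε N 1 ⟨μ, W, [(1, g)], y⟩

/-- Add `∑ x_i / ‖g_i‖_Q² • g_i g_iᵀ` to the matrix `A`. -/
def addOuter (Q : Matrix V V ℝ) :
    List (ℝ × (V → ℝ)) → Matrix V V ℝ → Timed (Matrix V V ℝ)
  | [], A => pure A
  | p :: l, A => do
    let s ← innerQ Q p.2 p.2
    let c ← div p.1 s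
    let A' ← mat fun u v => do
      let a ← mul (p.2 u) (p.2 v)
      let b ← mul c a
      add (A u v) b
    addOuter Q l A'

/-- The rescaling `R := (1 + ε)⁻² (R + ∑ x_i / ‖g_i‖_Q² • g_i g_iᵀ)`. -/
def rescale (Q R : Matrix V V ℝ) (ε : ℝ) (gs : List (ℝ × (V → ℝ))) :
    Timed (Matrix V V ℝ) := do
  let A ← addOuter Q gs R
  let b ← add 1 ε
  let c ← mul b b
  mat fun u v => div (A u v) c

/-- The main loop, with `T` rounds to go, in its `i`-th round. The result is `none` if some call of
the sliding von Neumann algorithm has tested its loop condition `N` times without having ended. -/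
def mainLoop (f : Finset V → ℤ) (ch : Choices V) (N : ℕ) (ε : ℝ) :
    ℕ → ℕ → ℝ → Finset V → Matrix V V ℝ → Matrix V V ℝ → Timed (Option (Finset V))
  | 0, _, _, W, _, _ => pure (some W)
  | T + 1, i, μ, W, Q, R => do
    charge 1
    let o ← slidingVonNeumann f (ch.order i) (ch.prefer i) N μ W Q ε
    match o with
    | none => pure none
    | some s => do
      if ← isZero s.y then pure (some s.W)
      else do
        let R' ← rescale Q R ε s.gs
        let Q' ← inverse R'
        mainLoop f ch N ε T (i + 1) s.μ s.W Q' R'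

/-- The algorithm Rescaling-SFM with at most `T` rescalings and `ε = 1 / (20 n)`. The number `N`
only serves to define the meaning of the while loop inside: the algorithm terminates with the
output `W` if the result is `some W` for some `N`. -/
def rescalingSFM (f : Finset V → ℤ) (ch : Choices V) (T N : ℕ) : Timed (Option (Finset V)) := do
  let Q ← identity
  let R ← identity
  let a ← mul 20 (Fintype.card V : ℝ)
  let ε ← div 1 a
  let b ← query f Finset.univ
  charge (Fintype.card V)
  if ← lt b 0 then do
    let μ ← sub 0 b
    mainLoop f ch N ε T 1 μ Finset.univ Q R
  else mainLoop f ch N ε T 1 0 ∅ Q R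

/-- The Euclidean norm of the vector `α(v) = max {|f({v})|, |f(V) - f(V ∖ {v})|}`, an upper bound on
`L_{f,2}`. -/
def alphaNorm (f : Finset V → ℤ) : Timed ℝ := do
  let b ← query f Finset.univ
  let α ← vec fun v => do
    charge (2 * Fintype.card V)
    let p ← query f {v}
    let q ← query f (Finset.univ.erase v)
    let p' ← abs p
    let d ← sub b q
    let q' ← abs d
    if ← lt p' q' then pure q' else pure p'
  let s ← dot α α
  sqrt s

/-- The variant of Rescaling-SFM that does not know `L_{f,2}` and computes the number of rescalings
from `‖α‖₂` instead (two multiplications, a logarithm, and rounding, after the norm). -/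
def rescalingSFMAlpha (f : Finset V → ℤ) (ch : Choices V) (N : ℕ) :
    Timed (Option (Finset V)) := do
  let Z ← alphaNorm f
  charge 4
  rescalingSFM f ch (numRescalings (Fintype.card V) Z) N

end Algorithm

end SFM

end

set_option linter.unusedSectionVars false

open Matrix

namespace SFM

section LinearAlgebra

variable {V : Type} [Fintype V] [DecidableEq V]

theorem dotProduct_mulVec_symm {R : Matrix V V ℝ} (hR : R.IsHermitian) (x y : V → ℝ) :
    x ⬝ᵥ (R *ᵥ y) = y ⬝ᵥ (R *ᵥ x) := by
  rw [dotProduct_mulVec, dotProduct_comm, ← mulVec_transpose]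
  congr 2

theorem posSemidef_quad_nonneg {R : Matrix V V ℝ} (hR : R.PosSemidef) (x : V → ℝ) :
    0 ≤ x ⬝ᵥ (R *ᵥ x) := by
  simpa using hR.dotProduct_mulVec_nonneg x

theorem posDef_quad_pos {R : Matrix V V ℝ} (hR : R.PosDef) {x : V → ℝ} (hx : x ≠ 0) :
    0 < x ⬝ᵥ (R *ᵥ x) := by
  simpa using hR.dotProduct_mulVec_pos hx

theorem posSemidef_cauchySchwarz {R : Matrix V V ℝ} (hR : R.PosSemidef) (x y : V → ℝ) :
    (x ⬝ᵥ (R *ᵥ y)) ^ 2 ≤ (x ⬝ᵥ (R *ᵥ x)) * (y ⬝ᵥ (R *ᵥ y)) := by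
  have h : ∀ t : ℝ, 0 ≤ (y ⬝ᵥ (R *ᵥ y)) * (t * t) + (2 * (x ⬝ᵥ (R *ᵥ y))) * t
      + x ⬝ᵥ (R *ᵥ x) := by
    intro t
    have := posSemidef_quad_nonneg hR (x + t • y)
    simp only [mulVec_add, mulVec_smul, dotProduct_add, add_dotProduct, dotProduct_smul,
      smul_dotProduct, smul_eq_mul, dotProduct_mulVec_symm hR.1 y x] at this
    linarith
  have := discrim_le_zero h
  rw [discrim] at this
  linarith

theorem inv_mulVec_cancel {R : Matrix V V ℝ} (hR : R.PosDef) (x : V → ℝ) :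
    R *ᵥ (R⁻¹ *ᵥ x) = x := by
  rw [mulVec_mulVec, Matrix.mul_nonsing_inv _ ((Matrix.isUnit_iff_isUnit_det _).1 hR.isUnit),
    one_mulVec]

/-- The Cauchy-Schwarz inequality for a positive definite form and its dual form. -/
theorem sq_dotProduct_le {R : Matrix V V ℝ} (hR : R.PosDef) (w g : V → ℝ) :
    (w ⬝ᵥ g) ^ 2 ≤ (w ⬝ᵥ (R *ᵥ w)) * (g ⬝ᵥ (R⁻¹ *ᵥ g)) := by
  have := posSemidef_cauchySchwarz hR.posSemidef w (R⁻¹ *ᵥ g)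
  rwa [inv_mulVec_cancel hR, dotProduct_comm (R⁻¹ *ᵥ g)] at this

theorem one_add_sum_le_prod {ι : Type*} (s : Finset ι) (a : ι → ℝ) (ha : ∀ i, 0 ≤ a i) :
    1 + ∑ i ∈ s, a i ≤ ∏ i ∈ s, (1 + a i) := by
  classical
  induction s using Finset.induction_on with
  | empty => simp
  | insert i s hi ih =>
    rw [Finset.sum_insert hi, Finset.prod_insert hi]
    have h1 : 0 ≤ ∑ i ∈ s, a i := Finset.sum_nonneg fun i _ => ha i
    nlinarith [ha i, mul_nonneg (ha i) h1]

theorem one_add_trace_le_det {P : Matrix V V ℝ} (hP : P.PosSemidef) :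
    1 + P.trace ≤ (1 + P).det := by
  have hd : (1 + P).det = ∏ i, (1 + hP.1.eigenvalues i) := by
    have h := hP.1.charpoly_eq
    have h2 := congrArg (Polynomial.eval (-1)) h
    rw [Matrix.eval_charpoly, Polynomial.eval_prod] at h2
    have h3 : (Matrix.scalar V (-1 : ℝ)) - P = -(1 + P) := by
      rw [map_neg, map_one]; abel
    rw [h3, Matrix.det_neg] at h2
    simp only [Polynomial.eval_sub, Polynomial.eval_X, Polynomial.eval_C] at h2
    have h4 : ∏ i, (-1 - (hP.1.eigenvalues i : ℝ)) =
        (-1) ^ Fintype.card V * ∏ i, (1 + hP.1.eigenvalues i) := by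
      rw [← Finset.card_univ, ← Finset.prod_const, ← Finset.prod_mul_distrib]
      exact Finset.prod_congr rfl fun i _ => by ring
    have h5 : ((-1 : ℝ)) ^ Fintype.card V ≠ 0 := by simp
    exact mul_left_cancel₀ h5 (h2.trans h4)
  rw [hd, hP.1.trace_eq_sum_eigenvalues]
  exact one_add_sum_le_prod _ _ fun i => hP.eigenvalues_nonneg i

open scoped MatrixOrder ComplexOrder in
theorem exists_eq_conjTranspose_mul_self {R : Matrix V V ℝ} (hR : R.PosSemidef) :
    ∃ B : Matrix V V ℝ, R = Bᴴ * B := by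
  refine ⟨CFC.sqrt R, ?_⟩
  have h0 : 0 ≤ R := nonneg_iff_posSemidef.2 hR
  have h1 : (CFC.sqrt R)ᴴ = CFC.sqrt R := (nonneg_iff_posSemidef.1 (CFC.sqrt_nonneg R)).1
  rw [h1, CFC.sqrt_mul_sqrt_self R h0]

theorem det_add_ge {R S : Matrix V V ℝ} (hR : R.PosDef) (hS : S.PosSemidef) :
    R.det * (1 + (R⁻¹ * S).trace) ≤ (R + S).det := by
  obtain ⟨B, hB⟩ := exists_eq_conjTranspose_mul_self hR.posSemidef
  have hRdet : 0 < R.det := hR.det_pos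
  have hdB : IsUnit B.det := by
    rw [isUnit_iff_ne_zero]
    intro h0
    rw [hB, det_mul, h0, mul_zero] at hRdet
    exact lt_irrefl _ hRdet
  have hdB' : IsUnit Bᴴ.det := by rw [det_conjTranspose]; simpa using hdB
  set P := B⁻¹ᴴ * S * B⁻¹ with hPdef
  have hP : P.PosSemidef := hS.conjTranspose_mul_mul_same _
  have h1 : R + S = Bᴴ * (1 + P) * B := by
    rw [mul_add, add_mul, mul_one, ← hB, hPdef, conjTranspose_nonsing_inv]
    congr 1
    rw [← Matrix.mul_assoc, ← Matrix.mul_assoc, Matrix.mul_nonsing_inv _ hdB', Matrix.one_mul,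
      Matrix.mul_assoc, Matrix.nonsing_inv_mul _ hdB, Matrix.mul_one]
  have h2 : P.trace = (R⁻¹ * S).trace := by
    rw [hPdef, hB, Matrix.mul_inv_rev, conjTranspose_nonsing_inv, Matrix.trace_mul_comm,
      Matrix.mul_assoc]
  rw [h1, det_mul, det_mul, ← h2, mul_right_comm, ← det_mul, ← hB]
  exact mul_le_mul_of_nonneg_left (one_add_trace_le_det hP) hRdet.le

theorem det_le_pow {R : Matrix V V ℝ} (hR : R.PosSemidef) {M : ℝ}
    (h : ∀ u : V → ℝ, u ⬝ᵥ (R *ᵥ u) ≤ M * ∑ v, u v ^ 2) : R.det ≤ M ^ Fintype.card V := by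
  rw [hR.1.det_eq_prod_eigenvalues, ← Finset.card_univ, ← Finset.prod_const]
  refine Finset.prod_le_prod (fun i _ => hR.eigenvalues_nonneg i) fun i _ => ?_
  have h1 := hR.1.eigenvalues_eq i
  have h2 := h (WithLp.ofLp (hR.1.eigenvectorBasis i))
  have h3 : ∑ v, (WithLp.ofLp (hR.1.eigenvectorBasis i)) v ^ 2 = 1 := by
    have := hR.1.eigenvectorBasis.orthonormal.1 i
    rw [EuclideanSpace.norm_eq, Real.sqrt_eq_one] at this
    simpa using this
  rw [h3, mul_one] at h2
  simp only [star_trivial, RCLike.re_to_real] at h1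
  simpa [h1] using h2

end LinearAlgebra

namespace Timed

section Values

variable {α β : Type}

@[simp] theorem val_pure (a : α) : (pure a : Timed α).val = a := rfl
@[simp] theorem val_bind (x : Timed α) (g : α → Timed β) : (x >>= g).val = (g x.val).val := rfl
@[simp] theorem val_ite (p : Prop) [Decidable p] (x y : Timed α) :
    (if p then x else y).val = if p then x.val else y.val := apply_ite _ _ _ _
@[simp] theorem val_query {V : Type} (f : Finset V → ℤ) (S : Finset V) :
    (query f S).val = (f S : ℝ) := rfl
@[simp] theorem val_add (a b : ℝ) : (add a b).val = a + b := rfl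
@[simp] theorem val_sub (a b : ℝ) : (sub a b).val = a - b := rfl
@[simp] theorem val_mul (a b : ℝ) : (mul a b).val = a * b := rfl
@[simp] theorem val_div (a b : ℝ) : (div a b).val = a / b := rfl
@[simp] theorem val_sqrt (a : ℝ) : (sqrt a).val = √a := rfl
@[simp] theorem val_abs (a : ℝ) : (abs a).val = |a| := rfl
@[simp] theorem val_lt (a b : ℝ) : (lt a b).val = true ↔ a < b := by simp [lt]
@[simp] theorem val_le (a b : ℝ) : (le a b).val = true ↔ a ≤ b := by simp [le]

variable {V : Type} [Fintype V] [DecidableEq V]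

@[simp] theorem val_vec (g : V → Timed ℝ) : (vec g).val = fun v => (g v).val := rfl
@[simp] theorem val_mat (g : V → V → Timed ℝ) :
    (mat g).val = Matrix.of fun u v => (g u v).val := rfl
@[simp] theorem val_sum (g : V → Timed ℝ) : (sum g).val = ∑ v, (g v).val := rfl
@[simp] theorem val_dot (x y : V → ℝ) : (dot x y).val = x ⬝ᵥ y := rfl
@[simp] theorem val_mulVec (Q : Matrix V V ℝ) (y : V → ℝ) : (mulVec Q y).val = Q *ᵥ y := rfl
@[simp] theorem val_innerQ (Q : Matrix V V ℝ) (x y : V → ℝ) :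
    (innerQ Q x y).val = x ⬝ᵥ (Q *ᵥ y) := rfl
@[simp] theorem val_normQ (Q : Matrix V V ℝ) (x : V → ℝ) :
    (normQ Q x).val = √(x ⬝ᵥ (Q *ᵥ x)) := rfl
theorem val_normalize (Q : Matrix V V ℝ) (x : V → ℝ) :
    (normalize Q x).val = (√(x ⬝ᵥ (Q *ᵥ x)))⁻¹ • x := by
  ext v
  simp [normalize, div_eq_inv_mul]
@[simp] theorem val_isZero (y : V → ℝ) : (isZero y).val = true ↔ y = 0 := by simp [isZero]
@[simp] theorem val_identity : (identity : Timed (Matrix V V ℝ)).val = 1 := by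
  ext u v
  simp [identity, Matrix.one_apply]

end Values

section GaussJordan

variable {V : Type} [Fintype V] [DecidableEq V]

/-- The state of Gauss-Jordan elimination after the columns in `J` have been treated: outside `J`,
the columns of `B` are still those of the identity, and the columns of `B * R` in `J` are already
those of the identity. -/
def PivotsDone (R B : Matrix V V ℝ) (J : Finset V) : Prop :=
  (∀ u, ∀ v ∉ J, B u v = (1 : Matrix V V ℝ) u v) ∧
    ∀ u, ∀ v ∈ J, (B * R) u v = (1 : Matrix V V ℝ) u v

theorem val_pivot (R B : Matrix V V ℝ) (j u v : V) :
    (pivot R B j).val u v = if u = j then B j v / (B * R) j j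
      else B u v - (B * R) u j * (B j v / (B * R) j j) := by
  simp [pivot, Matrix.mul_apply, Matrix.mulVec, dotProduct]

theorem val_pivot_mul (R B : Matrix V V ℝ) (j u v : V) :
    ((pivot R B j).val * R) u v = if u = j then (B * R) j v / (B * R) j j
      else (B * R) u v - (B * R) u j * ((B * R) j v / (B * R) j j) := by
  have h : ∀ w, (pivot R B j).val u w * R w v = if u = j then B j w * R w v / (B * R) j j
      else B u w * R w v - (B * R) u j * (B j w * R w v / (B * R) j j) := by
    intro w
    rw [val_pivot]
    split_ifs <;> ring
  rw [Matrix.mul_apply, Finset.sum_congr rfl fun w _ => h w]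
  split_ifs
  · rw [← Finset.sum_div, ← Matrix.mul_apply]
  · rw [Finset.sum_sub_distrib, ← Finset.mul_sum, ← Finset.sum_div, ← Matrix.mul_apply,
      ← Matrix.mul_apply]

theorem PivotsDone.pivot_pos {R B : Matrix V V ℝ} (hR : R.PosDef) {J : Finset V}
    (h : PivotsDone R B J) {j : V} (hj : j ∉ J) : 0 < (B * R) j j := by
  have hb : B j ≠ 0 := fun h0 => by
    have := h.1 j j hj
    rw [h0] at this
    simp at this
  have h1 := posDef_quad_pos hR hb
  have h2 : B j ⬝ᵥ (R *ᵥ B j) = ∑ v, (B * R) j v * B j v := by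
    rw [dotProduct_mulVec]
    rfl
  rw [h2, Finset.sum_eq_single j] at h1
  · simpa [h.1 j j hj] using h1
  · intro v _ hvj
    by_cases hv : v ∈ J
    · rw [h.2 j v hv, Matrix.one_apply_ne' hvj, zero_mul]
    · rw [h.1 j v hv, Matrix.one_apply_ne' hvj, mul_zero]
  · simp

theorem PivotsDone.pivot {R B : Matrix V V ℝ} (hR : R.PosDef) {J : Finset V}
    (h : PivotsDone R B J) {j : V} (hj : j ∉ J) :
    PivotsDone R (pivot R B j).val (insert j J) := by
  have hd := (h.pivot_pos hR hj).ne'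
  refine ⟨fun u v hv => ?_, fun u v hv => ?_⟩
  · rw [Finset.mem_insert, not_or] at hv
    have h0 : B j v = 0 := by rw [h.1 j v hv.2, Matrix.one_apply_ne' hv.1]
    rw [val_pivot, h0, h.1 u v hv.2]
    split_ifs with hu
    · subst hu
      rw [Matrix.one_apply_ne' hv.1, zero_div]
    · rw [zero_div, mul_zero, sub_zero]
  · rw [val_pivot_mul]
    rcases eq_or_ne v j with rfl | hvj
    · rw [div_self hd]
      split_ifs with hu
      · rw [hu, Matrix.one_apply_eq]
      · rw [Matrix.one_apply_ne hu, mul_one, sub_self]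
    · have hv' : v ∈ J := (Finset.mem_insert.1 hv).resolve_left hvj
      rw [h.2 j v hv', h.2 u v hv', Matrix.one_apply_ne' hvj]
      split_ifs with hu
      · subst hu
        simp [Matrix.one_apply_ne' hvj]
      · simp

theorem PivotsDone.pivots {R : Matrix V V ℝ} (hR : R.PosDef) :
    ∀ (l : List V) (B : Matrix V V ℝ) (J : Finset V), l.Nodup → (∀ v ∈ l, v ∉ J) →
      PivotsDone R B J → PivotsDone R (pivots R l B).val (l.toFinset ∪ J)
  | [], B, J, _, _, h => by simpa [Timed.pivots] using h
  | j :: l, B, J, hl, hJ, h => by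
    rw [List.nodup_cons] at hl
    have := PivotsDone.pivots hR l _ (insert j J) hl.2 (fun v hv => by
      rw [Finset.mem_insert, not_or]
      exact ⟨fun hvj => hl.1 (hvj ▸ hv), hJ v (List.mem_cons_of_mem _ hv)⟩)
      (h.pivot hR (hJ j List.mem_cons_self))
    simpa [Timed.pivots, Finset.insert_union] using this

/-- Gauss-Jordan elimination inverts a positive definite matrix. -/
theorem val_inverse {R : Matrix V V ℝ} (hR : R.PosDef) : (inverse R).val = R⁻¹ := by
  have h := PivotsDone.pivots hR Finset.univ.toList 1 ∅ (Finset.nodup_toList _) (by simp)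
    ⟨fun _ _ _ => rfl, by simp⟩
  refine (Matrix.inv_eq_left_inv ?_).symm
  ext u v
  simpa [inverse] using h.2 u v (by simp)

end GaussJordan

end Timed

section Bases

variable {V : Type} [Fintype V] [DecidableEq V]

/-- `g` is the extreme base defined by the order `l` for the set function `F`: its sums over the
prefixes of `l` are given by `F`. -/
def IsBaseOf (F : Finset V → ℝ) (l : List V) (g : V → ℝ) : Prop :=
  ∀ l₁, l₁ <+: l → ∑ v ∈ l₁.toFinset, g v = F l₁.toFinset

theorem IsBaseOf.nil {F : Finset V → ℝ} (hF : F ∅ = 0) (g : V → ℝ) : IsBaseOf F [] g := by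
  intro l₁ h
  rw [List.prefix_nil] at h
  simp [h, hF]

theorem IsBaseOf.of_prefix {F : Finset V → ℝ} {l l' : List V} {g : V → ℝ} (h : IsBaseOf F l g)
    (hl : l' <+: l) : IsBaseOf F l' g := fun l₁ h₁ => h l₁ (h₁.trans hl)

theorem toFinset_concat (l : List V) (v : V) : (l ++ [v]).toFinset = insert v l.toFinset := by
  ext u
  simp

theorem toFinset_of_forall_mem {l : List V} (h : ∀ v, v ∈ l) : l.toFinset = Finset.univ := by
  ext v
  simp [h v]

theorem length_of_forall_mem {l : List V} (hd : l.Nodup) (h : ∀ v, v ∈ l) :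
    l.length = Fintype.card V := by
  rw [← List.toFinset_card_of_nodup hd, toFinset_of_forall_mem h, Finset.card_univ]

theorem IsBaseOf.concat {F : Finset V → ℝ} {l : List V} {g : V → ℝ} (h : IsBaseOf F l g) {v : V}
    (hv : v ∉ l) :
    IsBaseOf F (l ++ [v]) (Function.update g v (F (insert v l.toFinset) - F l.toFinset)) := by
  have key : ∀ l₁, l₁ <+: l →
      ∑ u ∈ l₁.toFinset, Function.update g v (F (insert v l.toFinset) - F l.toFinset) u
        = F l₁.toFinset := by
    intro l₁ h₁
    rw [← h l₁ h₁]
    refine Finset.sum_congr rfl fun u hu => Function.update_of_ne ?_ _ _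
    rintro rfl
    exact hv (h₁.subset (List.mem_toFinset.1 hu))
  intro l₁ h₁
  rcases List.prefix_concat_iff.1 h₁ with rfl | h₁
  · rw [toFinset_concat, Finset.sum_insert (by simpa using hv), key l List.prefix_rfl,
      Function.update_self]
    ring
  · exact key l₁ h₁

theorem exists_isBaseOf {F : Finset V → ℝ} (hF : F ∅ = 0) (l : List V) (hl : l.Nodup) :
    ∃ g, IsBaseOf F l g := by
  induction l using List.reverseRecOn with
  | nil => exact ⟨0, IsBaseOf.nil hF 0⟩
  | append_singleton l v ih =>
    rw [List.nodup_append] at hl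
    obtain ⟨g, hg⟩ := ih hl.1
    exact ⟨_, hg.concat fun hv => hl.2.2 v hv v (by simp) rfl⟩

theorem notMem_of_concat_prefix {l l₁ : List V} {v : V} (hl : l.Nodup) (h : l₁ ++ [v] <+: l) :
    v ∉ l₁ := by
  have := hl.sublist h.sublist
  rw [List.nodup_append] at this
  exact fun hv => this.2.2 v hv v (by simp) rfl

theorem IsBaseOf.apply_eq {F : Finset V → ℝ} {l : List V} {g : V → ℝ} (h : IsBaseOf F l g)
    (hl : l.Nodup) {l₁ : List V} {v : V} (hv : l₁ ++ [v] <+: l) :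
    g v = F (insert v l₁.toFinset) - F l₁.toFinset := by
  rw [← h l₁ ((List.prefix_append _ _).trans hv), ← toFinset_concat, ← h _ hv, toFinset_concat,
    Finset.sum_insert (by simpa using notMem_of_concat_prefix hl hv)]
  ring

theorem exists_concat_prefix {l : List V} {v : V} (hv : v ∈ l) : ∃ l₁, l₁ ++ [v] <+: l := by
  obtain ⟨s, t, rfl⟩ := List.append_of_mem hv
  exact ⟨s, t, by simp⟩

theorem IsBaseOf.unique {F : Finset V → ℝ} {l : List V} {g g' : V → ℝ} (h : IsBaseOf F l g)
    (h' : IsBaseOf F l g') (hl : l.Nodup) (hV : ∀ v, v ∈ l) : g = g' := by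
  ext v
  obtain ⟨l₁, h₁⟩ := exists_concat_prefix (hV v)
  rw [h.apply_eq hl h₁, h'.apply_eq hl h₁]

theorem IsBaseOf.sum_univ {F : Finset V → ℝ} {l : List V} {g : V → ℝ} (h : IsBaseOf F l g)
    (hV : ∀ v, v ∈ l) : ∑ v, g v = F Finset.univ := by
  rw [← toFinset_of_forall_mem hV]
  exact h l List.prefix_rfl

theorem IsBaseOf.sum_le {F : Finset V → ℝ}
    (hF : ∀ X Y, F (X ∩ Y) + F (X ∪ Y) ≤ F X + F Y) (h0 : F ∅ = 0)
    {l : List V} {g : V → ℝ} (h : IsBaseOf F l g) (hl : l.Nodup) (hV : ∀ v, v ∈ l)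
    (S : Finset V) : ∑ v ∈ S, g v ≤ F S := by
  have key : ∀ l₁, l₁ <+: l → ∑ v ∈ S ∩ l₁.toFinset, g v ≤ F (S ∩ l₁.toFinset) := by
    intro l₁
    induction l₁ using List.reverseRecOn with
    | nil => simp [h0]
    | append_singleton l₁ v ih =>
      intro h₁
      have ih := ih ((List.prefix_append _ _).trans h₁)
      have hv := notMem_of_concat_prefix hl h₁
      rw [toFinset_concat]
      by_cases hvS : v ∈ S
      · rw [Finset.inter_insert_of_mem hvS, Finset.sum_insert (by simp [hv]), h.apply_eq hl h₁]
        have h2 := hF (insert v (S ∩ l₁.toFinset)) l₁.toFinset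
        have h3 : insert v (S ∩ l₁.toFinset) ∩ l₁.toFinset = S ∩ l₁.toFinset := by
          ext u
          simp only [Finset.mem_inter, Finset.mem_insert, List.mem_toFinset]
          constructor
          · rintro ⟨rfl | h, h'⟩
            · exact absurd h' hv
            · exact h
          · exact fun h => ⟨Or.inr h, h.2⟩
        have h4 : insert v (S ∩ l₁.toFinset) ∪ l₁.toFinset = insert v l₁.toFinset := by
          ext u
          simp only [Finset.mem_union, Finset.mem_inter, Finset.mem_insert, List.mem_toFinset]
          tauto
        rw [h3, h4] at h2
        linarith
      · rwa [Finset.inter_insert_of_notMem hvS]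
  simpa [toFinset_of_forall_mem hV] using key l List.prefix_rfl

/-- If the weights ascend along `l` and `F` is nonnegative on the prefixes of `l`, then the base
defined by `l` has nonnegative scalar product with `c - w`, for upper bounds `c` of `w`. -/
theorem IsBaseOf.weighted_sum_nonneg {F : Finset V → ℝ} {g w : V → ℝ} (l : List V) :
    IsBaseOf F l g → l.Nodup → l.Pairwise (fun u v => w u ≤ w v) →
      (∀ l₁, l₁ <+: l → 0 ≤ F l₁.toFinset) → ∀ c, (∀ v ∈ l, w v ≤ c) →
        0 ≤ ∑ v ∈ l.toFinset, (c - w v) * g v := by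
  induction l using List.reverseRecOn with
  | nil => simp
  | append_singleton l v ih =>
    intro h hl hw hF c hc
    have hpre : l <+: l ++ [v] := List.prefix_append _ _
    have hv : v ∉ l := notMem_of_concat_prefix hl List.prefix_rfl
    rw [List.pairwise_append] at hw
    have ih := ih (h.of_prefix hpre) (hl.sublist hpre.sublist) hw.1
      (fun l₁ h₁ => hF l₁ (h₁.trans hpre)) (w v) fun u hu => hw.2.2 u hu v (by simp)
    have h1 := hF _ List.prefix_rfl
    rw [← h _ List.prefix_rfl] at h1
    have h2 : ∑ u ∈ (l ++ [v]).toFinset, (c - w u) * g u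
        = ∑ u ∈ l.toFinset, (w v - w u) * g u
          + (c - w v) * ∑ u ∈ (l ++ [v]).toFinset, g u := by
      rw [toFinset_concat, Finset.sum_insert (by simpa using hv),
        Finset.sum_insert (by simpa using hv), mul_add, Finset.mul_sum, add_left_comm,
        ← Finset.sum_add_distrib]
      congr 1
      exact Finset.sum_congr rfl fun u _ => by ring
    rw [h2]
    exact add_nonneg ih (mul_nonneg (sub_nonneg.2 (hc v (by simp))) h1)

theorem IsBaseOf.dotProduct_nonpos {F : Finset V → ℝ} {g w : V → ℝ} {l : List V}
    (h : IsBaseOf F l g) (hl : l.Nodup) (hV : ∀ v, v ∈ l)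
    (hw : l.Pairwise (fun u v => w u ≤ w v)) (hF : ∀ l₁, l₁ <+: l → 0 ≤ F l₁.toFinset)
    (h0 : F Finset.univ = 0) : w ⬝ᵥ g ≤ 0 := by
  obtain ⟨c, hc⟩ : ∃ c, ∀ v, w v ≤ c :=
    ⟨∑ v, |w v|, fun v => (le_abs_self _).trans
      (Finset.single_le_sum (f := fun v => |w v|) (fun _ _ => abs_nonneg _) (Finset.mem_univ v))⟩
  have h1 := h.weighted_sum_nonneg l hl hw hF c fun v _ => hc v
  rw [toFinset_of_forall_mem hV] at h1
  simp only [sub_mul, Finset.sum_sub_distrib] at h1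
  rw [← Finset.mul_sum, h.sum_univ hV, h0, mul_zero] at h1
  rw [dotProduct]
  linarith

/-- Moving weight to the first entry of a base, and away from the last one. -/
theorem IsBaseOf.add_single_sub_single {F F' : Finset V → ℝ} {a b : V} {m : List V} {g : V → ℝ}
    (h : IsBaseOf F (a :: (m ++ [b])) g) (hl : (a :: (m ++ [b])).Nodup) {c d : ℝ}
    (h0 : F' ∅ = F ∅) (h1 : F' (a :: (m ++ [b])).toFinset = F (a :: (m ++ [b])).toFinset + c - d)
    (hF : ∀ S, S ≠ ∅ → S ≠ (a :: (m ++ [b])).toFinset → F' S = F S + c) :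
    IsBaseOf F' (a :: (m ++ [b])) (g + Pi.single a c - Pi.single b d) := by
  intro l₁ h₁
  have hsum : ∑ v ∈ l₁.toFinset, (g + Pi.single a c - Pi.single b d : V → ℝ) v
      = F l₁.toFinset + (if a ∈ l₁.toFinset then c else 0)
        - if b ∈ l₁.toFinset then d else 0 := by
    simp only [Pi.add_apply, Pi.sub_apply, Finset.sum_sub_distrib, Finset.sum_add_distrib,
      Finset.sum_pi_single', h l₁ h₁]
  rw [hsum]
  rw [← List.cons_append] at h₁ hl h1 hF
  rcases List.prefix_concat_iff.1 h₁ with rfl | h₂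
  · rw [if_pos (by simp), if_pos (by simp), h1]
  · have hb : b ∉ l₁ := fun hb => notMem_of_concat_prefix hl List.prefix_rfl (h₂.subset hb)
    rw [if_neg (show b ∉ l₁.toFinset by simpa using hb), sub_zero]
    rcases List.prefix_cons_iff.1 h₂ with rfl | ⟨l₂, rfl, -⟩
    · simp [h0]
    · rw [if_pos (by simp), hF]
      · simp
      · intro he
        have : b ∈ (a :: l₂).toFinset := he ▸ by simp
        exact hb (by simpa using this)

end Bases

section Slide

variable {V : Type} [Fintype V] [DecidableEq V]

/-- The sliding function `f_μ`. -/
def slide (f : Finset V → ℤ) (μ : ℝ) (S : Finset V) : ℝ :=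
  if S = ∅ ∨ S = Finset.univ then 0 else f S + μ

@[simp] theorem slide_empty (f : Finset V → ℤ) (μ : ℝ) : slide f μ ∅ = 0 := by simp [slide]

@[simp] theorem slide_univ (f : Finset V → ℤ) (μ : ℝ) : slide f μ Finset.univ = 0 := by
  simp [slide]

theorem slide_of_ne {f : Finset V → ℤ} {S : Finset V} (h0 : S ≠ ∅) (h1 : S ≠ Finset.univ)
    (μ : ℝ) : slide f μ S = f S + μ := by simp [slide, h0, h1]

theorem slide_mono (f : Finset V → ℤ) {μ ν : ℝ} (h : μ ≤ ν) (S : Finset V) :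
    slide f μ S ≤ slide f ν S := by
  unfold slide
  split_ifs <;> linarith

theorem slide_le {f : Finset V → ℤ} (hf : f ∅ = 0) {μ : ℝ} (h0 : 0 ≤ μ)
    (h1 : -(f Finset.univ : ℝ) ≤ μ) (S : Finset V) : slide f μ S ≤ f S + μ := by
  unfold slide
  split_ifs with h
  · rcases h with rfl | rfl
    · simpa [hf] using h0
    · linarith
  · exact le_rfl

theorem slide_submodular {f : Finset V → ℤ} (hs : IsSubmodular f) (hf : f ∅ = 0) {μ : ℝ}
    (h0 : 0 ≤ μ) (h1 : -(f Finset.univ : ℝ) ≤ μ) (X Y : Finset V) :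
    slide f μ (X ∩ Y) + slide f μ (X ∪ Y) ≤ slide f μ X + slide f μ Y := by
  by_cases hX0 : X = ∅
  · simp [hX0]
  by_cases hX1 : X = Finset.univ
  · simp [hX1, Finset.union_eq_left.2 (Finset.subset_univ Y)]
  by_cases hY0 : Y = ∅
  · simp [hY0]
  by_cases hY1 : Y = Finset.univ
  · simp [hY1, Finset.union_eq_right.2 (Finset.subset_univ X)]
  rw [slide_of_ne hX0 hX1, slide_of_ne hY0 hY1]
  have h2 := slide_le hf h0 h1 (X ∩ Y)
  have h3 := slide_le hf h0 h1 (X ∪ Y)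
  have h4 : (f (X ∩ Y) : ℝ) + f (X ∪ Y) ≤ f X + f Y := by exact_mod_cast hs X Y
  linarith

/-- `g` is an extreme base of `B(f_ν)` for some admissible `ν ≤ μ`. -/
def IsSlideBase (f : Finset V → ℤ) (μ : ℝ) (g : V → ℝ) : Prop :=
  ∃ ν ≤ μ, 0 ≤ ν ∧ -(f Finset.univ : ℝ) ≤ ν ∧
    ∃ l : List V, l.Nodup ∧ (∀ v, v ∈ l) ∧ IsBaseOf (slide f ν) l g

theorem IsSlideBase.mono {f : Finset V → ℤ} {μ ν : ℝ} {g : V → ℝ} (h : IsSlideBase f μ g)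
    (hμ : μ ≤ ν) : IsSlideBase f ν g := by
  obtain ⟨κ, hκ, h⟩ := h
  exact ⟨κ, hκ.trans hμ, h⟩

theorem IsSlideBase.sum_le {f : Finset V → ℤ} (hs : IsSubmodular f) (hf : f ∅ = 0) {μ : ℝ}
    {g : V → ℝ} (h : IsSlideBase f μ g) (S : Finset V) : ∑ v ∈ S, g v ≤ slide f μ S := by
  obtain ⟨κ, hκ, h0, h1, l, hl, hV, hg⟩ := h
  exact (hg.sum_le (slide_submodular hs hf h0 h1) (by simp) hl hV S).trans (slide_mono f hκ S)

end Slide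

section Norms

variable {V : Type} [Fintype V] [DecidableEq V]

theorem norm2_nonneg (x : V → ℝ) : 0 ≤ norm2 x := Real.sqrt_nonneg _

theorem norm2_sq (x : V → ℝ) : norm2 x ^ 2 = ∑ v, x v ^ 2 :=
  Real.sq_sqrt (Finset.sum_nonneg fun _ _ => sq_nonneg _)

theorem abs_le_norm2 (x : V → ℝ) (v : V) : |x v| ≤ norm2 x :=
  Real.abs_le_sqrt
    (Finset.single_le_sum (f := fun v => x v ^ 2) (fun _ _ => sq_nonneg _) (Finset.mem_univ v))

theorem norm2_mono {x a : V → ℝ} (h : ∀ v, |x v| ≤ a v) : norm2 x ≤ norm2 a :=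
  Real.sqrt_le_sqrt (Finset.sum_le_sum fun v _ => sq_le_sq' (by linarith [neg_abs_le (x v), h v])
    ((le_abs_self _).trans (h v)))

/-- The vector `α(v) = max {|f({v})|, |f(V) - f(V ∖ {v})|}`. -/
def alpha (f : Finset V → ℤ) (v : V) : ℝ :=
  max |(f {v} : ℝ)| |(f Finset.univ : ℝ) - f (Finset.univ.erase v)|

theorem abs_le_alpha {f : Finset V → ℤ} {x : V → ℝ} (hx : x ∈ basePolytope f) (v : V) :
    |x v| ≤ alpha f v := by
  have h1 := hx.1 {v}
  have h2 := hx.1 (Finset.univ.erase v)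
  have h3 := hx.2
  rw [Finset.sum_singleton] at h1
  rw [← Finset.add_sum_erase _ _ (Finset.mem_univ v)] at h3
  rw [abs_le]
  constructor
  · have := le_max_right |(f {v} : ℝ)| |(f Finset.univ : ℝ) - f (Finset.univ.erase v)|
    have := neg_abs_le ((f Finset.univ : ℝ) - f (Finset.univ.erase v))
    rw [alpha]
    linarith
  · exact h1.trans ((le_abs_self _).trans (le_max_left _ _))

theorem norm2_le_maxNorm {f : Finset V → ℤ} {x : V → ℝ} (hx : x ∈ basePolytope f) :
    norm2 x ≤ maxNorm f := by
  refine le_csSup ⟨norm2 (alpha f), ?_⟩ ⟨x, hx, rfl⟩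
  rintro _ ⟨y, hy, rfl⟩
  exact norm2_mono (abs_le_alpha hy)

theorem maxNorm_nonneg (f : Finset V → ℤ) : 0 ≤ maxNorm f := by
  refine Real.sSup_nonneg ?_
  rintro _ ⟨y, -, rfl⟩
  exact norm2_nonneg y

theorem maxNorm_le_norm2_alpha (f : Finset V → ℤ) : maxNorm f ≤ norm2 (alpha f) := by
  refine Real.sSup_le ?_ (norm2_nonneg _)
  rintro _ ⟨y, hy, rfl⟩
  exact norm2_mono (abs_le_alpha hy)

theorem IsBaseOf.mem_basePolytope {f : Finset V → ℤ} (hs : IsSubmodular f) (hf : f ∅ = 0)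
    {l : List V} {x : V → ℝ} (h : IsBaseOf (fun S => (f S : ℝ)) l x) (hl : l.Nodup)
    (hV : ∀ v, v ∈ l) : x ∈ basePolytope f :=
  ⟨fun S => h.sum_le (fun X Y => by exact_mod_cast hs X Y) (by simp [hf]) hl hV S, h.sum_univ hV⟩

theorem exists_base_sum_eq {f : Finset V → ℤ} (hs : IsSubmodular f) (hf : f ∅ = 0)
    (S : Finset V) : ∃ x ∈ basePolytope f, ∑ v ∈ S, x v = f S := by
  have hl : (S.toList ++ Sᶜ.toList).Nodup := by
    rw [List.nodup_append]
    refine ⟨S.nodup_toList, Sᶜ.nodup_toList, fun a ha b hb hab => ?_⟩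
    subst hab
    simp at ha hb
    exact hb ha
  have hV : ∀ v, v ∈ S.toList ++ Sᶜ.toList := fun v => by simpa using em _
  obtain ⟨x, hx⟩ := exists_isBaseOf (F := fun S => (f S : ℝ)) (by simp [hf]) _ hl
  refine ⟨x, hx.mem_basePolytope hs hf hl hV, ?_⟩
  simpa using hx S.toList (List.prefix_append _ _)

theorem alpha_le_maxNorm {f : Finset V → ℤ} (hs : IsSubmodular f) (hf : f ∅ = 0) (v : V) :
    alpha f v ≤ maxNorm f := by
  refine max_le ?_ ?_
  · obtain ⟨x, hx, h⟩ := exists_base_sum_eq hs hf {v}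
    rw [← h, Finset.sum_singleton]
    exact (abs_le_norm2 x v).trans (norm2_le_maxNorm hx)
  · obtain ⟨x, hx, h⟩ := exists_base_sum_eq hs hf (Finset.univ.erase v)
    rw [← h, ← hx.2, ← Finset.add_sum_erase _ _ (Finset.mem_univ v), add_sub_cancel_right]
    exact (abs_le_norm2 x v).trans (norm2_le_maxNorm hx)

theorem alpha_eq_zero {f : Finset V → ℤ} (hs : IsSubmodular f) (hf : f ∅ = 0)
    (h : maxNorm f < 1) (v : V) : alpha f v = 0 := by
  have h1 := (alpha_le_maxNorm hs hf v).trans_lt h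
  have h2 : alpha f v = (max |f {v}| |f Finset.univ - f (Finset.univ.erase v)| : ℤ) := by
    simp [alpha]
  rw [h2] at h1 ⊢
  have h3 : max |f {v}| |f Finset.univ - f (Finset.univ.erase v)| < 1 := by exact_mod_cast h1
  have h4 : 0 ≤ max |f {v}| |f Finset.univ - f (Finset.univ.erase v)| :=
    (abs_nonneg _).trans (le_max_left _ _)
  exact_mod_cast (by omega : max |f {v}| |f Finset.univ - f (Finset.univ.erase v)| = 0)

theorem norm2_alpha_le {f : Finset V → ℤ} (hs : IsSubmodular f) (hf : f ∅ = 0) :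
    norm2 (alpha f) ≤ √(Fintype.card V) * maxNorm f := by
  rw [← Real.sqrt_sq (maxNorm_nonneg f), ← Real.sqrt_mul (Nat.cast_nonneg _)]
  refine Real.sqrt_le_sqrt ?_
  calc ∑ v, alpha f v ^ 2 ≤ ∑ _v : V, maxNorm f ^ 2 :=
        Finset.sum_le_sum fun v _ => pow_le_pow_left₀ ((abs_nonneg _).trans (le_max_left _ _))
          (alpha_le_maxNorm hs hf v) 2
    _ = _ := by simp

theorem one_le_maxNorm {f : Finset V → ℤ} (hs : IsSubmodular f) (hf : f ∅ = 0) {S : Finset V}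
    (hS : f S ≠ 0) : 1 ≤ maxNorm f := by
  by_contra! h
  obtain ⟨x, hx, hxS⟩ := exists_base_sum_eq hs hf S
  have h0 : ∀ v, x v = 0 := fun v => by
    have := abs_le_alpha hx v
    rw [alpha_eq_zero hs hf h v] at this
    exact abs_nonpos_iff.1 this
  simp only [h0, Finset.sum_const_zero] at hxS
  exact hS (by exact_mod_cast hxS.symm)

theorem sum_abs_le {f : Finset V → ℤ} {x : V → ℝ} (hx : x ∈ basePolytope f) :
    (∑ v, |x v|) ^ 2 ≤ Fintype.card V * maxNorm f ^ 2 := by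
  have h1 := sq_sum_le_card_mul_sum_sq (s := Finset.univ) (f := fun v => |x v|)
  simp only [sq_abs, Finset.card_univ] at h1
  rw [← norm2_sq] at h1
  refine h1.trans (mul_le_mul_of_nonneg_left ?_ (Nat.cast_nonneg _))
  exact pow_le_pow_left₀ (norm2_nonneg _) (norm2_le_maxNorm hx) 2

/-- The extreme bases of `B(f_ν)` are short as long as `f_ν` is negative somewhere. -/
theorem IsSlideBase.sum_sq_le {f : Finset V → ℤ} (hs : IsSubmodular f) (hf : f ∅ = 0) {μ : ℝ}
    {g : V → ℝ} (h : IsSlideBase f μ g) {S : Finset V} (hS : (f S : ℝ) ≤ -μ)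
    (hn : 2 ≤ Fintype.card V) :
    ∑ v, g v ^ 2 ≤ 2 * (Fintype.card V + 1) * maxNorm f ^ 2 := by
  obtain ⟨ν, hν, h0, h1, l, hl, hV, hg⟩ := h
  obtain ⟨x, hx⟩ := exists_isBaseOf (F := fun S => (f S : ℝ)) (by simp [hf]) l hl
  have hxB := hx.mem_basePolytope hs hf hl hV
  have hlen := length_of_forall_mem hl hV
  have huniv := toFinset_of_forall_mem hV
  obtain ⟨a, l', rfl⟩ := List.exists_cons_of_length_pos (l := l) (by omega)
  obtain ⟨m, b, rfl⟩ : ∃ m b, l' = m ++ [b] := by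
    rcases List.eq_nil_or_concat l' with rfl | ⟨m, b, h⟩
    · simp at hlen; omega
    · exact ⟨m, b, by simpa using h⟩
  have hg' := hx.add_single_sub_single (F' := slide f ν) (c := ν) (d := f Finset.univ + ν) hl
    (by simp [hf]) (by rw [huniv]; simp)
    (fun S hS hS' => slide_of_ne hS (by rwa [huniv] at hS') ν)
  rw [hg.unique hg' hl hV]
  obtain ⟨z, hz, hzS⟩ := exists_base_sum_eq hs hf S
  have h2 : ν + (f Finset.univ + ν) ≤ ∑ v, |z v| := by
    have e1 : ∑ v ∈ S, z v + ∑ v ∈ Sᶜ, z v = f Finset.univ := by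
      rw [Finset.sum_add_sum_compl, hz.2]
    have e2 : ∑ v ∈ S, |z v| + ∑ v ∈ Sᶜ, |z v| = ∑ v, |z v| := Finset.sum_add_sum_compl _ _
    have e3 : -∑ v ∈ S, z v ≤ ∑ v ∈ S, |z v| := by
      rw [← Finset.sum_neg_distrib]
      exact Finset.sum_le_sum fun v _ => neg_le_abs _
    have e4 : ∑ v ∈ Sᶜ, z v ≤ ∑ v ∈ Sᶜ, |z v| := Finset.sum_le_sum fun v _ => le_abs_self _
    linarith
  have h3 : (ν + (f Finset.univ + ν)) ^ 2 ≤ Fintype.card V * maxNorm f ^ 2 :=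
    (pow_le_pow_left₀ (by linarith) h2 2).trans (sum_abs_le hz)
  have h4 : ∑ v, x v ^ 2 ≤ maxNorm f ^ 2 := by
    rw [← norm2_sq]
    exact pow_le_pow_left₀ (norm2_nonneg _) (norm2_le_maxNorm hxB) 2
  have h5 : ∀ v, (x + Pi.single a ν - Pi.single b ((f Finset.univ : ℝ) + ν) : V → ℝ) v ^ 2 ≤
      2 * x v ^ 2 + 2 * ((if v = a then ν ^ 2 else 0)
        + if v = b then ((f Finset.univ : ℝ) + ν) ^ 2 else 0) := by
    intro v
    have : 0 ≤ ν * (f Finset.univ + ν) := mul_nonneg h0 (by linarith)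
    simp only [Pi.add_apply, Pi.sub_apply, Pi.single_apply]
    split_ifs
    · nlinarith [sq_nonneg (x v - (ν - (f Finset.univ + ν)))]
    · nlinarith [sq_nonneg (x v - ν)]
    · nlinarith [sq_nonneg (x v + (f Finset.univ + ν))]
    · nlinarith [sq_nonneg (x v)]
  have h6 := Finset.sum_le_sum fun v (_ : v ∈ Finset.univ) => h5 v
  rw [Finset.sum_add_distrib, ← Finset.mul_sum, ← Finset.mul_sum, Finset.sum_add_distrib,
    Finset.sum_ite_eq', Finset.sum_ite_eq', if_pos (Finset.mem_univ _),
    if_pos (Finset.mem_univ _)] at h6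
  nlinarith [mul_nonneg h0 (by linarith : 0 ≤ (f Finset.univ : ℝ) + ν)]

end Norms

open Timed

section Values

variable {V : Type} [Fintype V] [DecidableEq V]

@[simp] theorem val_evalSlide (f : Finset V → ℤ) (μ : ℝ) (S : Finset V) :
    (evalSlide f μ S).val = slide f μ S := by
  simp only [evalSlide, slide, val_bind, val_ite, val_pure, val_query, val_add]

theorem isBaseOf_greedyAux (f : Finset V → ℤ) (μ : ℝ) :
    ∀ (l l₀ : List V) (x : V → ℝ), (l₀ ++ l).Nodup → IsBaseOf (slide f μ) l₀ x →
      IsBaseOf (slide f μ) (l₀ ++ l)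
        (greedyAux f μ l l₀.toFinset (slide f μ l₀.toFinset) x).val
  | [], l₀, x, _, hx => by simpa [greedyAux] using hx
  | v :: l, l₀, x, hl, hx => by
    have h : l₀ ++ v :: l = (l₀ ++ [v]) ++ l := by simp
    rw [h] at hl ⊢
    have hv : v ∉ l₀ := notMem_of_concat_prefix hl (List.prefix_append _ _)
    have := isBaseOf_greedyAux f μ l (l₀ ++ [v]) _ hl (hx.concat hv)
    rw [toFinset_concat] at this
    simpa [greedyAux] using this

theorem isBaseOf_extremeBase (f : Finset V → ℤ) (μ : ℝ) {l : List V} (hl : l.Nodup) :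
    IsBaseOf (slide f μ) l (extremeBase f μ l).val := by
  have := isBaseOf_greedyAux f μ l [] 0 hl (IsBaseOf.nil (by simp) 0)
  simpa [extremeBase] using this

theorem insertBy_perm (w : V → ℝ) (v : V) :
    ∀ l : List V, ((insertBy w v l).val).Perm (v :: l)
  | [] => by simp [insertBy]
  | u :: l => by
    simp only [insertBy, val_bind, val_ite, val_pure]
    split_ifs
    · exact List.Perm.refl _
    · exact ((insertBy_perm w v l).cons u).trans (List.Perm.swap v u l)

theorem sortBy_perm (w : V → ℝ) : ∀ l : List V, ((sortBy w l).val).Perm l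
  | [] => by simp [sortBy]
  | v :: l => by
    simp only [sortBy, val_bind]
    exact (insertBy_perm w v _).trans ((sortBy_perm w l).cons v)

theorem insertBy_sorted (w : V → ℝ) (v : V) :
    ∀ l : List V, l.Pairwise (fun a b => w a ≤ w b) →
      ((insertBy w v l).val).Pairwise (fun a b => w a ≤ w b)
  | [], _ => by simp [insertBy]
  | u :: l, h => by
    have h' := List.pairwise_cons.1 h
    simp only [insertBy, val_bind, val_ite, val_pure, val_le]
    split_ifs with hvu
    · refine List.pairwise_cons.2 ⟨fun a ha => ?_, h⟩
      rcases List.mem_cons.1 ha with rfl | ha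
      · exact hvu
      · exact hvu.trans (h'.1 a ha)
    · refine List.pairwise_cons.2 ⟨fun a ha => ?_, insertBy_sorted w v l h'.2⟩
      rcases List.mem_cons.1 ((insertBy_perm w v l).subset ha) with rfl | ha
      · exact (not_le.1 hvu).le
      · exact h'.1 a ha

theorem sortBy_sorted (w : V → ℝ) :
    ∀ l : List V, ((sortBy w l).val).Pairwise (fun a b => w a ≤ w b)
  | [] => by simp [sortBy]
  | v :: l => by
    simp only [sortBy, val_bind]
    exact insertBy_sorted w v _ (sortBy_sorted w l)

theorem slide_minPrefixAux_le (f : Finset V → ℤ) (μ : ℝ) (prefer : Finset V → Bool) :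
    ∀ (l l₀ : List V) (S : Finset V),
      (∀ l₁, l₁ <+: l₀ → l₁ ≠ [] → slide f μ S ≤ slide f μ l₁.toFinset) →
      ∀ l₁, l₁ <+: l₀ ++ l → l₁ ≠ [] →
        slide f μ (minPrefixAux f μ prefer l l₀.toFinset S (slide f μ S)).val
          ≤ slide f μ l₁.toFinset
  | [], l₀, S, h => by simpa [minPrefixAux] using h
  | v :: l, l₀, S, h => by
    have hap : l₀ ++ v :: l = (l₀ ++ [v]) ++ l := by simp
    rw [hap]
    have key : ∀ S', slide f μ S' ≤ slide f μ S →
        slide f μ S' ≤ slide f μ (insert v l₀.toFinset) →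
        ∀ l₁, l₁ <+: (l₀ ++ [v]) ++ l → l₁ ≠ [] →
        slide f μ (minPrefixAux f μ prefer l (insert v l₀.toFinset) S' (slide f μ S')).val
          ≤ slide f μ l₁.toFinset := by
      intro S' h1 h2
      rw [← toFinset_concat]
      refine slide_minPrefixAux_le f μ prefer l (l₀ ++ [v]) S' fun l₁ h₁ hne => ?_
      rcases List.prefix_concat_iff.1 h₁ with rfl | h₁
      · rwa [toFinset_concat]
      · exact h1.trans (h l₁ h₁ hne)
    simp only [minPrefixAux, val_bind, val_ite, val_evalSlide]
    by_cases hp : prefer (insert v l₀.toFinset) = true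
    · simp only [hp, if_true, val_le]
      split_ifs with hq
      · exact key _ hq le_rfl
      · exact key _ le_rfl (not_le.1 hq).le
    · simp only [hp, Bool.false_eq_true, if_false, val_lt]
      split_ifs with hq
      · exact key _ hq.le le_rfl
      · exact key _ le_rfl (not_lt.1 hq)

theorem slide_minPrefix_le (f : Finset V → ℤ) (μ : ℝ) (prefer : Finset V → Bool) {l l₁ : List V}
    (h : l₁ <+: l) (hne : l₁ ≠ []) :
    slide f μ (minPrefix f μ prefer l).val ≤ slide f μ l₁.toFinset := by
  cases l with
  | nil => exact absurd (List.prefix_nil.1 h) hne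
  | cons v l =>
    have := slide_minPrefixAux_le f μ prefer l [v] {v} (fun l₂ h₂ hne => by
      rcases List.prefix_cons_iff.1 h₂ with rfl | ⟨t, rfl, ht⟩
      · exact absurd rfl hne
      · rw [List.prefix_nil] at ht
        simp [ht]) l₁ h hne
    simpa [minPrefix] using this

@[simp] theorem val_scaleCoeffs (c : ℝ) :
    ∀ l : List (ℝ × (V → ℝ)), (scaleCoeffs c l).val = l.map fun p => (c * p.1, p.2)
  | [] => rfl
  | p :: l => by simp [scaleCoeffs, val_scaleCoeffs c l]

theorem val_slideBase {a b : V} (hab : a ≠ b) (m : List V) (δ : ℝ) (g : V → ℝ) :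
    (slideBase (a :: (m ++ [b])) δ g).val = g + Pi.single a δ - Pi.single b δ := by
  have h1 : (a :: (m ++ [b])).getLast? = some b := by
    rw [← List.cons_append, List.getLast?_concat]
  simp only [slideBase, h1, List.head?_cons, val_bind, val_pure, val_add, val_sub]
  ext v
  by_cases hb : v = b
  · subst hb
    simp [Ne.symm hab]
  · rw [Function.update_of_ne hb]
    by_cases ha : v = a
    · subst ha
      simp [hab]
    · simp [ha, hb]

end Values

section NextBase

variable {V : Type} [Fintype V] [DecidableEq V]

/-- The relation between the value `μ` and the set `W` maintained by the algorithm. -/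
structure IsValid (f : Finset V → ℤ) (μ : ℝ) (W : Finset V) : Prop where
  nonneg : 0 ≤ μ
  neg_le : -(f Finset.univ : ℝ) ≤ μ
  eq_neg : (f W : ℝ) = -μ

theorem nextBase_spec {f : Finset V → ℤ} {order : List V} (ho : order.Nodup)
    (hV : ∀ v, v ∈ order) (prefer : Finset V → Bool) (Q : Matrix V V ℝ) {s : VNState V}
    (hs : IsValid f s.μ s.W) {r : ℝ × Finset V × (V → ℝ)}
    (hr : (nextBase f order prefer Q s).val = r) :
    s.μ ≤ r.1 ∧ IsValid f r.1 r.2.1 ∧ IsSlideBase f r.1 r.2.2 ∧ (Q *ᵥ s.y) ⬝ᵥ r.2.2 ≤ 0 := by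
  set w := Q *ᵥ s.y with hw
  have hperm := sortBy_perm w order
  have hsort := sortBy_sorted w order
  set l := (sortBy w order).val with hl
  have hnd : l.Nodup := hperm.nodup_iff.2 ho
  have hmem : ∀ v, v ∈ l := fun v => hperm.mem_iff.2 (hV v)
  have hg := isBaseOf_extremeBase f s.μ hnd
  set g := (extremeBase f s.μ l).val with hgdef
  by_cases hc : 0 < w ⬝ᵥ g
  · set W := (minPrefix f s.μ prefer l).val with hW
    have hr' : r = (0 - (f W : ℝ), W, (slideBase l (0 - slide f s.μ W) g).val) := by
      rw [← hr]
      simp only [nextBase, val_bind, val_mulVec, val_dot, val_lt, ← hw, ← hl, ← hgdef,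
        if_pos hc, ← hW, val_evalSlide, val_sub, val_query, val_pure]
    obtain ⟨l₁, hl₁, hneg⟩ : ∃ l₁, l₁ <+: l ∧ slide f s.μ l₁.toFinset < 0 := by
      by_contra! hcon
      exact absurd (hg.dotProduct_nonpos hnd hmem hsort hcon (by simp)) (not_le.2 hc)
    have hne : l₁ ≠ [] := by
      rintro rfl
      simp at hneg
    have hWneg := (slide_minPrefix_le f s.μ prefer hl₁ hne).trans_lt hneg
    rw [← hW] at hWneg
    have hW0 : W ≠ ∅ := fun h => by rw [h, slide_empty] at hWneg; exact lt_irrefl _ hWneg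
    have hW1 : W ≠ Finset.univ := fun h => by
      rw [h, slide_univ] at hWneg; exact lt_irrefl _ hWneg
    have hWs := slide_of_ne hW0 hW1 s.μ (f := f)
    have hshape : ∃ a m b, l = a :: (m ++ [b]) := by
      cases hcase : l with
      | nil => rw [hcase] at hl₁; exact absurd (List.prefix_nil.1 hl₁) hne
      | cons a l' =>
        rcases List.eq_nil_or_concat l' with h | ⟨m, b, h⟩
        · exfalso
          rw [hcase, h] at hl₁
          rcases List.prefix_cons_iff.1 hl₁ with h₁ | ⟨t, h₁, ht⟩
          · exact hne h₁
          · rw [List.prefix_nil] at ht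
            rw [h₁, ht, ← h, ← hcase, toFinset_of_forall_mem hmem, slide_univ] at hneg
            exact lt_irrefl _ hneg
        · exact ⟨a, m, b, by simp [h]⟩
    obtain ⟨a, m, b, hshape⟩ := hshape
    have hab : a ≠ b := by
      rw [hshape, List.nodup_cons] at hnd
      rintro rfl
      exact hnd.1 (by simp)
    have huniv := toFinset_of_forall_mem hmem
    have hg' : IsBaseOf (slide f (0 - f W)) l (slideBase l (0 - slide f s.μ W) g).val := by
      rw [hshape] at hg hnd huniv ⊢
      rw [val_slideBase hab]
      refine hg.add_single_sub_single hnd (by simp) (by rw [huniv]; simp) fun S hS hS' => ?_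
      rw [huniv] at hS'
      rw [slide_of_ne hS hS', slide_of_ne hS hS', hWs]
      ring
    have hμ : s.μ ≤ 0 - f W := by linarith
    have hval : IsValid f (0 - f W) W :=
      ⟨hs.nonneg.trans hμ, hs.neg_le.trans hμ, by ring⟩
    subst hr'
    refine ⟨hμ, hval, ⟨_, le_rfl, hval.1, hval.2, l, hnd, hmem, hg'⟩, ?_⟩
    refine hg'.dotProduct_nonpos hnd hmem hsort (fun l₂ hl₂ => ?_) (by simp)
    by_cases h0 : l₂.toFinset = ∅
    · simp [h0]
    by_cases h1 : l₂.toFinset = Finset.univ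
    · simp [h1]
    have h2 := slide_minPrefix_le f s.μ prefer hl₂ (by rintro rfl; simp at h0)
    rw [← hW, hWs, slide_of_ne h0 h1] at h2
    rw [slide_of_ne h0 h1]
    linarith
  · have hr' : r = (s.μ, s.W, g) := by
      rw [← hr]
      simp only [nextBase, val_bind, val_mulVec, val_dot, val_lt, ← hw, ← hl, ← hgdef,
        if_neg hc, val_pure]
    subst hr'
    exact ⟨le_rfl, hs, ⟨_, le_rfl, hs.1, hs.2, l, hnd, hmem, hg⟩, not_lt.1 hc⟩

end NextBase

section VonNeumann

variable {V : Type} [Fintype V] [DecidableEq V]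

/-- The invariant of the sliding von Neumann algorithm before its loop condition is tested for the
`k`-th time. -/
structure VNInv (f : Finset V → ℤ) (Q : Matrix V V ℝ) (k : ℕ) (s : VNState V) : Prop where
  valid : IsValid f s.μ s.W
  coeff_nonneg : ∀ p ∈ s.gs, 0 ≤ p.1
  base : ∀ p ∈ s.gs, IsSlideBase f s.μ p.2
  sum_one : (s.gs.map fun p => p.1).sum = 1
  y_eq : s.y = (s.gs.map fun p => p.1 • ((√(p.2 ⬝ᵥ (Q *ᵥ p.2)))⁻¹ • p.2)).sum
  norm_le : k * (s.y ⬝ᵥ (Q *ᵥ s.y)) ≤ 1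
  ne_zero : s.y ≠ 0 → ∀ p ∈ s.gs, p.2 ≠ 0
  length_eq : s.gs.length = k

theorem normalized_quad_le_one {Q : Matrix V V ℝ} (hQ : Q.PosSemidef) (g : V → ℝ) :
    ((√(g ⬝ᵥ (Q *ᵥ g)))⁻¹ • g) ⬝ᵥ (Q *ᵥ ((√(g ⬝ᵥ (Q *ᵥ g)))⁻¹ • g)) ≤ 1 := by
  have h0 := posSemidef_quad_nonneg hQ g
  simp only [mulVec_smul, dotProduct_smul, smul_dotProduct, smul_eq_mul]
  rw [← mul_assoc, ← mul_inv, Real.mul_self_sqrt h0]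
  exact inv_mul_le_one

theorem segment_quad_le {A B C : ℝ} {k : ℕ} (hA : 0 < A) (hB : B ≤ 0) (hC0 : 0 ≤ C) (hC : C ≤ 1)
    (hk : k * A ≤ 1) {t : ℝ} (ht : t = (A - B) / (A - 2 * B + C)) :
    0 ≤ t ∧ t ≤ 1 ∧
      ((k + 1 : ℕ) : ℝ) * ((1 - t) ^ 2 * A + 2 * (t * (1 - t)) * B + t ^ 2 * C) ≤ 1 := by
  have hden : 0 < A - 2 * B + C := by linarith
  have h1 : (1 - t) ^ 2 * A + 2 * (t * (1 - t)) * B + t ^ 2 * C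
      = (A * C - B ^ 2) / (A - 2 * B + C) := by
    have htD : t * (A - 2 * B + C) = A - B := by rw [ht, div_mul_cancel₀ _ hden.ne']
    rw [eq_div_iff hden.ne']
    linear_combination (t * (A - 2 * B + C) - A + B) * htD
  refine ⟨?_, ?_, ?_⟩
  · rw [ht]
    exact div_nonneg (by linarith) hden.le
  · rw [ht, div_le_one hden]
    linarith
  · rw [h1, mul_div_assoc', div_le_one hden]
    push_cast
    nlinarith [mul_le_mul_of_nonneg_right hk hC0, mul_le_mul_of_nonneg_left hC hA.le,
      mul_nonneg (by positivity : (0 : ℝ) ≤ k + 1) (sq_nonneg B)]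

theorem vnStep_spec {f : Finset V → ℤ} {order : List V} (ho : order.Nodup)
    (hV : ∀ v, v ∈ order) (prefer : Finset V → Bool) {Q : Matrix V V ℝ} (hQ : Q.PosDef) {k : ℕ}
    {s : VNState V} (hs : VNInv f Q k s) (hy : s.y ≠ 0) {s' : VNState V}
    (hs' : (vnStep f order prefer Q s).val = s') : VNInv f Q (k + 1) s' ∧ s.μ ≤ s'.μ := by
  rcases hr : (nextBase f order prefer Q s).val with ⟨μ, W, g⟩
  obtain ⟨hμ, hvalid, hbase, hdot⟩ := nextBase_spec ho hV prefer Q hs.valid hr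
  dsimp only at hμ hvalid hbase hdot
  set h := (√(g ⬝ᵥ (Q *ᵥ g)))⁻¹ • g with hh
  set A := s.y ⬝ᵥ (Q *ᵥ s.y) with hA
  set B := s.y ⬝ᵥ (Q *ᵥ h) with hB
  set C := h ⬝ᵥ (Q *ᵥ h) with hC
  have hB' : h ⬝ᵥ (Q *ᵥ s.y) = B := dotProduct_mulVec_symm hQ.1 _ _
  have hA0 : 0 < A := posDef_quad_pos hQ hy
  have hB0 : B ≤ 0 := by
    rw [← hB', hh, smul_dotProduct, smul_eq_mul]
    exact mul_nonpos_of_nonneg_of_nonpos (by positivity) ((dotProduct_comm _ _).trans_le hdot)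
  have hC0 : 0 ≤ C := posSemidef_quad_nonneg hQ.posSemidef h
  have hC1 : C ≤ 1 := normalized_quad_le_one hQ.posSemidef g
  obtain ⟨t, ht⟩ : ∃ t, t = (A - B) / (A - 2 * B + C) := ⟨_, rfl⟩
  obtain ⟨ht0, ht1, hnorm⟩ := segment_quad_le hA0 hB0 hC0 hC1 hs.norm_le ht
  have hval : s' = ⟨μ, W, (t, g) :: s.gs.map fun p => ((1 - t) * p.1, p.2),
      (1 - t) • s.y + t • h⟩ := by
    have e0 : (fun v => s.y v - h v) = s.y - h := rfl
    have e1 : (s.y - h) ⬝ᵥ (Q *ᵥ s.y) = A - B := by rw [sub_dotProduct, hB']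
    have e2 : (s.y - h) ⬝ᵥ (Q *ᵥ (s.y - h)) = A - 2 * B + C := by
      rw [mulVec_sub, dotProduct_sub, sub_dotProduct, sub_dotProduct, hB']
      ring
    rw [← hs']
    simp only [vnStep, val_bind, hr, val_normalize, val_vec, val_sub, val_innerQ, val_div,
      val_mul, val_add, val_scaleCoeffs, val_pure, ← hh, e0, e1, e2, ← ht]
    rfl
  subst hval
  refine ⟨⟨hvalid, ?_, ?_, ?_, ?_, ?_, ?_, ?_⟩, hμ⟩
  · intro p hp
    rcases List.mem_cons.1 hp with rfl | hp
    · exact ht0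
    · obtain ⟨q, hq, rfl⟩ := List.mem_map.1 hp
      exact mul_nonneg (by linarith) (hs.coeff_nonneg q hq)
  · intro p hp
    rcases List.mem_cons.1 hp with rfl | hp
    · exact hbase
    · obtain ⟨q, hq, rfl⟩ := List.mem_map.1 hp
      exact (hs.base q hq).mono hμ
  · simp only [List.map_cons, List.map_map, List.sum_cons, Function.comp_def]
    rw [List.sum_map_mul_left, hs.sum_one]
    ring
  · simp only [List.map_cons, List.map_map, List.sum_cons, Function.comp_def, ← hh, mul_smul]
    rw [add_comm]
    congr 1
    conv_lhs => rw [hs.y_eq]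
    rw [List.smul_sum, List.map_map]
    rfl
  · refine le_trans (le_of_eq ?_) hnorm
    simp only [mulVec_add, mulVec_smul, dotProduct_add, add_dotProduct, dotProduct_smul,
      smul_dotProduct, smul_eq_mul, hB', ← hA, ← hB, ← hC]
    ring
  · intro hy' p hp
    rcases List.mem_cons.1 hp with rfl | hp
    · rintro hg
      dsimp only at hg
      have hh0 : h = 0 := by rw [hh, hg, smul_zero]
      have hB1 : B = 0 := by rw [hB, hh0, mulVec_zero, dotProduct_zero]
      have hC1 : C = 0 := by rw [hC, hh0, zero_dotProduct]
      have ht' : t = 1 := by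
        rw [ht, hB1, hC1, mul_zero, sub_zero, add_zero, div_self hA0.ne']
      apply hy'
      simp [ht', hh0]
    · obtain ⟨q, hq, rfl⟩ := List.mem_map.1 hp
      exact hs.ne_zero hy q hq
  · simp [hs.length_eq]

theorem vnLoop_spec {f : Finset V → ℤ} {order : ℕ → List V} (ho : ∀ k, (order k).Nodup)
    (hV : ∀ k v, v ∈ order k) (prefer : ℕ → Finset V → Bool) {Q : Matrix V V ℝ} (hQ : Q.PosDef)
    {ε : ℝ} (hε : 0 < ε) : ∀ (N k : ℕ) (s : VNState V), VNInv f Q k s →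
      1 ≤ ε ^ 2 * (k + N : ℕ) →
      ∃ s' k', (vnLoop f order prefer Q ε (N + 1) k s).val = some s' ∧ k' ≤ k + N ∧
        VNInv f Q k' s' ∧ s.μ ≤ s'.μ ∧ s'.y ⬝ᵥ (Q *ᵥ s'.y) ≤ ε ^ 2
  | N, k, s, hs, hN => by
    have h0 := posSemidef_quad_nonneg hQ.posSemidef s.y
    rw [vnLoop]
    simp only [val_bind, val_ite, val_lt, val_normQ, val_pure]
    split_ifs with hlt
    · have hlt' : ε ^ 2 < s.y ⬝ᵥ (Q *ᵥ s.y) := (Real.lt_sqrt hε.le).1 hlt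
      have hy : s.y ≠ 0 := by
        rintro hy
        rw [hy, zero_dotProduct] at hlt'
        exact absurd hlt' (not_lt.2 (sq_nonneg ε))
      obtain ⟨hinv, hμ⟩ := vnStep_spec (ho k) (hV k) (prefer k) hQ hs hy rfl
      cases N with
      | zero =>
        exfalso
        have h1 := hs.norm_le
        rw [add_zero] at hN
        have hk : 0 < (k : ℝ) := by
          by_contra! hk
          nlinarith [sq_nonneg ε]
        nlinarith
      | succ N =>
        obtain ⟨s', k', h1, h2, h3, h4, h5⟩ := vnLoop_spec ho hV prefer hQ hε N (k + 1) _ hinv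
          (by rwa [show k + 1 + N = k + (N + 1) by ring])
        exact ⟨s', k', h1, by omega, h3, hμ.trans h4, h5⟩
    · exact ⟨s, k, rfl, by omega, hs, le_rfl, (Real.sqrt_le_left hε.le).1 (not_lt.1 hlt)⟩

theorem slidingVonNeumann_spec {f : Finset V → ℤ} {order : ℕ → List V}
    (ho : ∀ k, (order k).Nodup) (hV : ∀ k v, v ∈ order k) (prefer : ℕ → Finset V → Bool)
    {Q : Matrix V V ℝ} (hQ : Q.PosDef) {ε : ℝ} (hε : 0 < ε) {N : ℕ} (hN : 1 ≤ ε ^ 2 * N)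
    {μ : ℝ} {W : Finset V} (hW : IsValid f μ W) :
    ∃ s k, (slidingVonNeumann f order prefer N μ W Q ε).val = some s ∧ k ≤ N ∧
      VNInv f Q k s ∧ μ ≤ s.μ ∧ s.y ⬝ᵥ (Q *ᵥ s.y) ≤ ε ^ 2 := by
  cases N with
  | zero => norm_num at hN
  | succ N =>
    have hg := isBaseOf_extremeBase f μ (ho 0)
    set g := (extremeBase f μ (order 0)).val with hgdef
    obtain ⟨s, k, h1, h2, h3, h4, h5⟩ := vnLoop_spec ho hV prefer hQ hε N 1
      ⟨μ, W, [(1, g)], (normalize Q g).val⟩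
      ⟨hW, by simp, by
        intro p hp
        rw [List.mem_singleton.1 hp]
        exact ⟨μ, le_rfl, hW.1, hW.2, order 0, ho 0, hV 0, hg⟩, by simp, by
        simp [val_normalize], by
        simpa [val_normalize] using normalized_quad_le_one hQ.posSemidef g, by
        rintro hy p hp hp0
        rw [List.mem_singleton.1 hp] at hp0
        dsimp only at hp0 hy
        rw [val_normalize, hp0, smul_zero] at hy
        exact hy rfl, by simp⟩ (by rwa [add_comm])
    exact ⟨s, k, h1, by omega, h3, h4, h5⟩

theorem sum_mul_eq_zero_imp {α : Type} (a b : α → ℝ) :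
    ∀ l : List α, (∀ p ∈ l, 0 ≤ a p) → (∀ p ∈ l, b p < 0) →
      (l.map fun p => a p * b p).sum ≤ 0 ∧
        ((l.map fun p => a p * b p).sum = 0 → (l.map fun p => a p).sum = 0)
  | [], _, _ => by simp
  | p :: l, ha, hb => by
    obtain ⟨h1, h2⟩ := sum_mul_eq_zero_imp a b l
      (fun q hq => ha q (List.mem_cons_of_mem _ hq)) (fun q hq => hb q (List.mem_cons_of_mem _ hq))
    have h3 := ha p List.mem_cons_self
    have h4 := hb p List.mem_cons_self
    have h5 : a p * b p ≤ 0 := mul_nonpos_of_nonneg_of_nonpos h3 h4.le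
    simp only [List.map_cons, List.sum_cons]
    refine ⟨by linarith, fun h => ?_⟩
    have h6 : a p * b p = 0 := by linarith
    rw [h2 (by linarith), (mul_eq_zero.1 h6).resolve_right h4.ne, add_zero]

theorem dotProduct_list_sum {α : Type} (w : V → ℝ) (F : α → V → ℝ) :
    ∀ l : List α, w ⬝ᵥ (l.map F).sum = (l.map fun p => w ⬝ᵥ F p).sum
  | [] => by simp
  | p :: l => by simp [dotProduct_add, dotProduct_list_sum w F l]

/-- If the sliding von Neumann algorithm reaches zero, then `W` is a minimizer. -/
theorem VNInv.minimal {f : Finset V → ℤ} (hs : IsSubmodular f) (hf : f ∅ = 0)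
    {Q : Matrix V V ℝ} (hQ : Q.PosDef) {k : ℕ} {s : VNState V} (h : VNInv f Q k s)
    (hy : s.y = 0) (S : Finset V) : f s.W ≤ f S := by
  have hW := h.valid
  suffices hS : 0 ≤ slide f s.μ S by
    have h1 := hS.trans (slide_le hf hW.1 hW.2 S)
    have h2 := hW.3
    have : (f s.W : ℝ) ≤ f S := by linarith
    exact_mod_cast this
  by_contra! hneg
  have hsum : ∀ g : V → ℝ, (S.piecewise 1 0 : V → ℝ) ⬝ᵥ g = ∑ v ∈ S, g v := by
    intro g
    rw [dotProduct, ← Finset.sum_subset (Finset.subset_univ S)]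
    · exact Finset.sum_congr rfl fun v hv => by simp [hv]
    · intro v _ hv
      simp [hv]
  have h1 := congrArg (fun x => (S.piecewise 1 0 : V → ℝ) ⬝ᵥ x) h.y_eq
  simp only [hy, dotProduct_zero, dotProduct_list_sum, dotProduct_smul, smul_eq_mul] at h1
  have h2 := (sum_mul_eq_zero_imp (fun p : ℝ × (V → ℝ) => p.1)
    (fun p => (√(p.2 ⬝ᵥ (Q *ᵥ p.2)))⁻¹ * ((S.piecewise 1 0 : V → ℝ) ⬝ᵥ p.2)) s.gs
    h.coeff_nonneg (fun p hp => by
      have h3 := ((h.base p hp).sum_le hs hf S).trans_lt hneg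
      have hp0 : p.2 ≠ 0 := by
        intro h0
        simp [h0] at h3
      have h4 := posDef_quad_pos hQ hp0
      rw [hsum]
      exact mul_neg_of_pos_of_neg (by positivity) h3)).2 h1.symm
  rw [h.sum_one] at h2
  exact one_ne_zero h2

end VonNeumann

section Rescaling

variable {V : Type} [Fintype V] [DecidableEq V]

/-- The matrix `∑ x_i / ‖g_i‖_Q² • g_i g_iᵀ`. -/
noncomputable def outerSum (Q : Matrix V V ℝ) (gs : List (ℝ × (V → ℝ))) : Matrix V V ℝ :=
  (gs.map fun p => (p.1 / (p.2 ⬝ᵥ (Q *ᵥ p.2))) • vecMulVec p.2 p.2).sum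

theorem val_addOuter (Q : Matrix V V ℝ) :
    ∀ (gs : List (ℝ × (V → ℝ))) (A : Matrix V V ℝ),
      (addOuter Q gs A).val = A + outerSum Q gs
  | [], A => by simp [addOuter, outerSum]
  | p :: l, A => by
    simp only [addOuter, val_bind, val_addOuter Q l, outerSum, List.map_cons, List.sum_cons]
    rw [← add_assoc]
    congr 1

theorem val_rescale (Q R : Matrix V V ℝ) (ε : ℝ) (gs : List (ℝ × (V → ℝ))) :
    (rescale Q R ε gs).val = ((1 + ε) ^ 2)⁻¹ • (R + outerSum Q gs) := by
  ext u v
  simp [rescale, val_addOuter, div_eq_inv_mul, sq]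

theorem vecMulVec_quad (g w : V → ℝ) : w ⬝ᵥ (vecMulVec g g *ᵥ w) = (w ⬝ᵥ g) ^ 2 := by
  rw [vecMulVec_mulVec, dotProduct_comm g w]
  simp [sq]

theorem outerSum_quad (Q : Matrix V V ℝ) (w : V → ℝ) : ∀ gs : List (ℝ × (V → ℝ)),
    w ⬝ᵥ (outerSum Q gs *ᵥ w)
      = (gs.map fun p => p.1 / (p.2 ⬝ᵥ (Q *ᵥ p.2)) * (w ⬝ᵥ p.2) ^ 2).sum
  | [] => by simp [outerSum]
  | p :: l => by
    have := outerSum_quad Q w l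
    unfold outerSum at this ⊢
    simp only [List.map_cons, List.sum_cons, add_mulVec, dotProduct_add, this, smul_mulVec,
      dotProduct_smul, vecMulVec_quad, smul_eq_mul]

theorem outerSum_posSemidef {Q : Matrix V V ℝ} (hQ : Q.PosSemidef) :
    ∀ gs : List (ℝ × (V → ℝ)), (∀ p ∈ gs, 0 ≤ p.1) → (outerSum Q gs).PosSemidef
  | [], _ => by simpa [outerSum] using PosSemidef.zero
  | p :: l, h => by
    have h1 := outerSum_posSemidef hQ l fun q hq => h q (List.mem_cons_of_mem _ hq)
    have h2 : (vecMulVec p.2 p.2).PosSemidef := by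
      simpa using posSemidef_vecMulVec_self_star p.2
    have h3 := h2.smul (div_nonneg (h p List.mem_cons_self) (posSemidef_quad_nonneg hQ p.2))
    unfold outerSum at h1 ⊢
    rw [List.map_cons, List.sum_cons]
    exact h3.add h1

theorem trace_mul_outerSum {Q : Matrix V V ℝ} (hQ : Q.PosDef) :
    ∀ gs : List (ℝ × (V → ℝ)), (∀ p ∈ gs, p.2 ≠ 0) →
      (Q * outerSum Q gs).trace = (gs.map fun p => p.1).sum
  | [], _ => by simp [outerSum]
  | p :: l, h => by
    have h1 := trace_mul_outerSum hQ l fun q hq => h q (List.mem_cons_of_mem _ hq)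
    have h2 := posDef_quad_pos hQ (h p List.mem_cons_self)
    unfold outerSum at h1 ⊢
    rw [List.map_cons, List.sum_cons, Matrix.mul_add, trace_add, h1, List.map_cons, List.sum_cons,
      Matrix.mul_smul, trace_smul, mul_vecMulVec, trace_vecMulVec, smul_eq_mul,
      dotProduct_comm (Q *ᵥ p.2), div_mul_cancel₀ _ h2.ne']

/-- `w` has nonnegative scalar product with the bases of `B(f_ν)`, for all admissible `ν ≤ μ`. -/
def InCone (f : Finset V → ℤ) (μ : ℝ) (w : V → ℝ) : Prop :=
  ∀ g, IsSlideBase f μ g → 0 ≤ w ⬝ᵥ g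

theorem InCone.anti {f : Finset V → ℤ} {μ ν : ℝ} {w : V → ℝ} (h : InCone f ν w) (hμ : μ ≤ ν) :
    InCone f μ w := fun g hg => h g (hg.mono hμ)

theorem VNInv.outerSum_quad_le {f : Finset V → ℤ} {R : Matrix V V ℝ} (hR : R.PosDef) {k : ℕ}
    {s : VNState V} (h : VNInv f R⁻¹ k s) {ε : ℝ} (hε : 0 ≤ ε)
    (hy : s.y ⬝ᵥ (R⁻¹ *ᵥ s.y) ≤ ε ^ 2) {w : V → ℝ} (hw : InCone f s.μ w) :
    w ⬝ᵥ (outerSum R⁻¹ s.gs *ᵥ w) ≤ ε * (w ⬝ᵥ (R *ᵥ w)) := by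
  have hq := posSemidef_quad_nonneg hR.posSemidef w
  set M := √(w ⬝ᵥ (R *ᵥ w)) with hM
  have hM0 : 0 ≤ M := Real.sqrt_nonneg _
  have hM2 : M ^ 2 = w ⬝ᵥ (R *ᵥ w) := Real.sq_sqrt hq
  have h1 : w ⬝ᵥ s.y ≤ M * ε := by
    refine le_of_sq_le_sq ?_ (mul_nonneg hM0 hε)
    calc (w ⬝ᵥ s.y) ^ 2 ≤ (w ⬝ᵥ (R *ᵥ w)) * (s.y ⬝ᵥ (R⁻¹ *ᵥ s.y)) := sq_dotProduct_le hR _ _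
      _ ≤ (M * ε) ^ 2 := by
        rw [mul_pow, hM2]
        exact mul_le_mul_of_nonneg_left hy hq
  have h2 : ∀ p ∈ s.gs, p.1 / (p.2 ⬝ᵥ (R⁻¹ *ᵥ p.2)) * (w ⬝ᵥ p.2) ^ 2 ≤
      M * (p.1 * ((√(p.2 ⬝ᵥ (R⁻¹ *ᵥ p.2)))⁻¹ * (w ⬝ᵥ p.2))) := by
    intro p hp
    have h3 := h.coeff_nonneg p hp
    have h4 := hw p.2 (h.base p hp)
    have h5 := posSemidef_quad_nonneg hR.inv.posSemidef p.2
    set q := p.2 ⬝ᵥ (R⁻¹ *ᵥ p.2) with hqdef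
    have h6 : (√q)⁻¹ * (w ⬝ᵥ p.2) ≤ M := by
      rcases h5.eq_or_lt with h0 | h0
      · rw [← h0]; simpa using hM0
      rw [inv_mul_le_iff₀ (Real.sqrt_pos.2 h0)]
      refine le_of_sq_le_sq ?_ (by positivity)
      rw [mul_pow, Real.sq_sqrt h5, hM2, mul_comm]
      exact sq_dotProduct_le hR _ _
    have h7 : p.1 / q * (w ⬝ᵥ p.2) ^ 2
        = ((√q)⁻¹ * (w ⬝ᵥ p.2)) * (p.1 * ((√q)⁻¹ * (w ⬝ᵥ p.2))) := by
      have : q⁻¹ = (√q)⁻¹ * (√q)⁻¹ := by rw [← mul_inv, Real.mul_self_sqrt h5]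
      rw [div_eq_mul_inv, this]
      ring
    rw [h7]
    exact mul_le_mul_of_nonneg_right h6 (by positivity)
  rw [outerSum_quad]
  refine (List.sum_le_sum h2).trans ?_
  rw [List.sum_map_mul_left]
  have h3 : (s.gs.map fun p => p.1 * ((√(p.2 ⬝ᵥ (R⁻¹ *ᵥ p.2)))⁻¹ * (w ⬝ᵥ p.2))).sum
      = w ⬝ᵥ s.y := by
    rw [h.y_eq, dotProduct_list_sum]
    simp only [dotProduct_smul, smul_eq_mul]
  rw [h3, ← hM2]
  nlinarith

theorem one_add_pow_le {n : ℕ} (hn : 0 < n) :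
    ((1 + 1 / (20 * (n : ℝ))) ^ 2) ^ n ≤ 5 / 4 := by
  have hn' : (0 : ℝ) < n := by exact_mod_cast hn
  have h1 : 1 + 1 / (20 * (n : ℝ)) ≤ Real.exp (1 / (20 * n)) := by
    rw [add_comm]
    exact Real.add_one_le_exp _
  calc ((1 + 1 / (20 * (n : ℝ))) ^ 2) ^ n ≤ (Real.exp (1 / (20 * n)) ^ 2) ^ n := by gcongr
    _ = Real.exp (1 / 10) := by
      rw [← Real.exp_nat_mul, ← Real.exp_nat_mul]
      congr 1
      push_cast
      field_simp
      norm_num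
    _ ≤ 5 / 4 := by
      have h2 := Real.one_sub_le_exp_neg (1 / 10)
      rw [Real.exp_neg] at h2
      have h3 := Real.exp_pos (1 / 10)
      rw [le_inv_comm₀ (by norm_num) h3] at h2
      exact h2.trans (by norm_num)

/-- The effect of a rescaling. -/
theorem VNInv.rescale_spec [Nonempty V] {f : Finset V → ℤ} {R : Matrix V V ℝ} (hR : R.PosDef)
    {k : ℕ} {s : VNState V} (h : VNInv f R⁻¹ k s) {ε : ℝ} (hε : ε = 1 / (20 * (Fintype.card V : ℝ)))
    (hy : s.y ⬝ᵥ (R⁻¹ *ᵥ s.y) ≤ ε ^ 2) (hy0 : s.y ≠ 0) {R' : Matrix V V ℝ}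
    (hR' : (rescale R⁻¹ R ε s.gs).val = R') :
    R'.PosDef ∧ 8 / 5 * R.det ≤ R'.det ∧
      ∀ w, InCone f s.μ w → w ⬝ᵥ (R' *ᵥ w) ≤ w ⬝ᵥ (R *ᵥ w) := by
  have hε0 : 0 < ε := by rw [hε]; have := Fintype.card_pos (α := V); positivity
  have hS := outerSum_posSemidef hR.inv.posSemidef s.gs h.coeff_nonneg
  rw [val_rescale] at hR'
  subst hR'
  refine ⟨(hR.add_posSemidef hS).smul (by positivity), ?_, fun w hw => ?_⟩
  · have h1 := det_add_ge hR hS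
    rw [trace_mul_outerSum hR.inv _ (h.ne_zero hy0), h.sum_one] at h1
    have h2 := one_add_pow_le (Fintype.card_pos (α := V))
    rw [← hε] at h2
    have h3 : 0 < ((1 + ε) ^ 2) ^ Fintype.card V := by positivity
    rw [det_smul, inv_pow, le_inv_mul_iff₀ h3]
    nlinarith [hR.det_pos]
  · have h1 := h.outerSum_quad_le hR hε0.le hy hw
    have h2 := posSemidef_quad_nonneg hR.posSemidef w
    rw [smul_mulVec, dotProduct_smul, smul_eq_mul, add_mulVec, dotProduct_add,
      inv_mul_le_iff₀ (by positivity)]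
    nlinarith [mul_nonneg hε0.le h2, mul_nonneg (mul_nonneg hε0.le hε0.le) h2]

end Rescaling

section MainLoop

variable {V : Type} [Fintype V] [DecidableEq V]

theorem one_le_eps_sq_mul [Nonempty V] {ε : ℝ} (hε : ε = 1 / (20 * (Fintype.card V : ℝ))) :
    1 ≤ ε ^ 2 * (400 * Fintype.card V ^ 2 : ℕ) := by
  have h : (0 : ℝ) < Fintype.card V := by exact_mod_cast Fintype.card_pos (α := V)
  rw [hε]
  push_cast
  field_simp
  norm_num

/-- The outcome of the main loop: the set that is returned is a minimizer, or else there is a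
matrix with a large determinant whose quadratic form is small on the cone. -/
theorem mainLoop_spec [Nonempty V] {f : Finset V → ℤ} (hs : IsSubmodular f) (hf : f ∅ = 0)
    (ch : Choices V) {ε : ℝ} (hε : ε = 1 / (20 * (Fintype.card V : ℝ))) :
    ∀ (T i : ℕ) (μ : ℝ) (W : Finset V) (R : Matrix V V ℝ), IsValid f μ W → R.PosDef →
      ∃ W', (mainLoop f ch (400 * Fintype.card V ^ 2) ε T i μ W R⁻¹ R).val = some W' ∧
        ((∀ S, f W' ≤ f S) ∨ ∃ μ' R', μ ≤ μ' ∧ IsValid f μ' W' ∧ R'.PosDef ∧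
          (8 / 5) ^ T * R.det ≤ R'.det ∧
            ∀ w, InCone f μ' w → w ⬝ᵥ (R' *ᵥ w) ≤ w ⬝ᵥ (R *ᵥ w))
  | 0, i, μ, W, R, hW, hR =>
    ⟨W, rfl, Or.inr ⟨μ, R, le_rfl, hW, hR, by simp, fun _ _ => le_rfl⟩⟩
  | T + 1, i, μ, W, R, hW, hR => by
    have hε0 : 0 < ε := by rw [hε]; have := Fintype.card_pos (α := V); positivity
    obtain ⟨s, k, h1, -, h3, h4, h5⟩ := slidingVonNeumann_spec (ch.order_nodup i)
      (ch.mem_order i) (ch.prefer i) hR.inv hε0 (one_le_eps_sq_mul hε) hW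
    rw [mainLoop]
    simp only [val_bind, h1, val_ite, val_isZero]
    by_cases hy : s.y = 0
    · rw [if_pos hy]
      exact ⟨s.W, rfl, Or.inl (h3.minimal hs hf hR.inv hy)⟩
    · rw [if_neg hy]
      obtain ⟨e1, e2, e3⟩ := h3.rescale_spec hR hε h5 hy rfl
      rw [val_inverse e1]
      obtain ⟨W', hW', h6⟩ := mainLoop_spec hs hf ch hε T (i + 1) s.μ s.W _ h3.valid e1
      refine ⟨W', hW', h6.imp_right ?_⟩
      rintro ⟨μ', R', k1, k2, k3, k4, k5⟩
      refine ⟨μ', R', h4.trans k1, k2, k3, le_trans ?_ k4, fun w hw =>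
        (k5 w hw).trans (e3 w (hw.anti k1))⟩
      rw [pow_succ, mul_assoc]
      exact mul_le_mul_of_nonneg_left e2 (by positivity)

/-- Near the negative of the incidence vector of a set with `f_μ(S) ≤ -1` lies a ball that is
contained in the cone. -/
theorem inCone_of_small {f : Finset V → ℤ} (hs : IsSubmodular f) (hf : f ∅ = 0) {μ : ℝ}
    (h0 : 0 ≤ μ) (h1 : -(f Finset.univ : ℝ) ≤ μ) {S : Finset V} (hS : (f S : ℝ) + μ ≤ -1)
    (hn : 2 ≤ Fintype.card V) {u : V → ℝ}
    (hu : (∑ v, u v ^ 2) * (2 * (Fintype.card V + 1) * maxNorm f ^ 2) ≤ 1) :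
    InCone f μ (u - S.piecewise 1 0) := by
  intro g hg
  have hgS := (hg.sum_le hs hf S).trans ((slide_le hf h0 h1 S).trans hS)
  have hg2 := hg.sum_sq_le hs hf (S := S) (by linarith) hn
  have hcs := Finset.sum_mul_sq_le_sq_mul_sq Finset.univ u g
  have h3 : (∑ v, u v ^ 2) * ∑ v, g v ^ 2 ≤ 1 :=
    (mul_le_mul_of_nonneg_left hg2 (Finset.sum_nonneg fun _ _ => sq_nonneg _)).trans hu
  have h4 : -1 ≤ ∑ v, u v * g v := (abs_le_one_iff_mul_self_le_one.2 (by nlinarith) |> abs_le.1).1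
  have h5 : (S.piecewise 1 0 : V → ℝ) ⬝ᵥ g = ∑ v ∈ S, g v := by
    rw [dotProduct, ← Finset.sum_subset (Finset.subset_univ S)]
    · exact Finset.sum_congr rfl fun v hv => by simp [hv]
    · intro v _ hv
      simp [hv]
  rw [sub_dotProduct, h5, dotProduct]
  linarith

/-- If `W` is not a minimizer, then a form that is small on the cone has a small determinant. -/
theorem det_le_of_not_minimal {f : Finset V → ℤ} (hs : IsSubmodular f) (hf : f ∅ = 0) {μ : ℝ}
    {W : Finset V} (hW : IsValid f μ W) {S : Finset V} (hS : f S < f W) {R : Matrix V V ℝ}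
    (hR : R.PosDef) (hcone : ∀ w, InCone f μ w → w ⬝ᵥ (R *ᵥ w) ≤ w ⬝ᵥ w) :
    2 ≤ Fintype.card V ∧ 1 ≤ maxNorm f ∧
      R.det ≤ ((Fintype.card V * maxNorm f) ^ 3) ^ Fintype.card V := by
  obtain ⟨h0, h1, h2⟩ := hW
  have hS' : (f S : ℝ) + μ ≤ -1 := by
    have : (f S : ℝ) + 1 ≤ f W := by exact_mod_cast hS
    linarith
  have hS0 : S ≠ ∅ := by
    rintro rfl
    rw [hf] at hS'
    push_cast at hS'
    linarith
  have hS1 : S ≠ Finset.univ := by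
    rintro rfl
    linarith
  have hcard : S.card + 1 ≤ Fintype.card V := by
    have := Finset.card_lt_card (Finset.ssubset_univ_iff.2 hS1)
    rwa [Finset.card_univ] at this
  have hcard0 : 1 ≤ S.card := Finset.card_pos.2 (Finset.nonempty_iff_ne_empty.2 hS0)
  have hn : 2 ≤ Fintype.card V := by omega
  have hL : 1 ≤ maxNorm f := one_le_maxNorm hs hf (S := S) fun h => by
    rw [h] at hS'
    push_cast at hS'
    linarith
  refine ⟨hn, hL, ?_⟩
  set n := Fintype.card V with hndef
  set L := maxNorm f with hLdef
  have hnR : (2 : ℝ) ≤ n := by exact_mod_cast hn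
  set G : ℝ := 2 * (n + 1) * L ^ 2 with hG
  have hG0 : 0 < G := by positivity
  set z : V → ℝ := S.piecewise 1 0 with hz
  have hzz : z ⬝ᵥ z = S.card := by
    rw [dotProduct, ← Finset.sum_subset (Finset.subset_univ S)]
    · rw [Finset.sum_congr rfl fun v hv => by rw [hz, Finset.piecewise_eq_of_mem _ _ _ hv]]
      simp
    · intro v _ hv
      simp [hz, hv]
  have hball : ∀ u : V → ℝ, (∑ v, u v ^ 2) * G ≤ 1 →
      u ⬝ᵥ (R *ᵥ u) ≤ u ⬝ᵥ u + S.card := by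
    intro u hu
    have e1 := hcone _ (inCone_of_small hs hf h0 h1 hS' hn hu)
    have e2 := hcone _ (inCone_of_small hs hf h0 h1 hS' hn (u := -u) (by simpa using hu))
    rw [← hz] at e1 e2
    have e3 := posSemidef_quad_nonneg hR.posSemidef z
    simp only [mulVec_sub, mulVec_neg, dotProduct_sub, sub_dotProduct, dotProduct_neg,
      neg_dotProduct, hzz] at e1 e2
    linarith
  have hM : ∀ u : V → ℝ, u ⬝ᵥ (R *ᵥ u) ≤ (1 + S.card * G) * ∑ v, u v ^ 2 := by
    intro u
    have huu : u ⬝ᵥ u = ∑ v, u v ^ 2 := Finset.sum_congr rfl fun v _ => (sq (u v)).symm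
    rcases (Finset.sum_nonneg fun v (_ : v ∈ Finset.univ) => sq_nonneg (u v)).eq_or_lt with h | h
    · have : u = 0 := by
        rw [← huu] at h
        exact dotProduct_self_eq_zero.1 h.symm
      simp [this]
    · set c := (√((∑ v, u v ^ 2) * G))⁻¹ with hc
      have hc2 : c * c * ((∑ v, u v ^ 2) * G) = 1 := by
        rw [hc, ← mul_inv, Real.mul_self_sqrt (by positivity)]
        exact inv_mul_cancel₀ (by positivity)
      have hc0 : 0 < c * c := by
        have : 0 < c := by rw [hc]; positivity
        positivity
      have hcu : ∑ v, (c • u) v ^ 2 = c * c * ∑ v, u v ^ 2 := by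
        rw [Finset.mul_sum]
        exact Finset.sum_congr rfl fun v _ => by
          rw [Pi.smul_apply, smul_eq_mul]
          ring
      have e1 := hball (c • u) (by rw [hcu, mul_assoc]; exact hc2.le)
      simp only [mulVec_smul, dotProduct_smul, smul_dotProduct, smul_eq_mul, huu] at e1
      refine le_of_mul_le_mul_left ?_ hc0
      nlinarith
  refine (det_le_pow hR.posSemidef hM).trans ?_
  refine pow_le_pow_left₀ (by positivity) ?_ _
  have hcR : (S.card : ℝ) ≤ n - 1 := by
    have : ((S.card + 1 : ℕ) : ℝ) ≤ n := by exact_mod_cast hcard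
    push_cast at this
    linarith
  have hL2 : 1 ≤ L ^ 2 := one_le_pow₀ hL
  have hnL : 2 ≤ n * L := by nlinarith
  calc 1 + S.card * G ≤ 1 + (n - 1) * G := by gcongr
    _ = 1 - 2 * L ^ 2 + 2 * (n * L) ^ 2 := by rw [hG]; ring
    _ ≤ 2 * (n * L) ^ 2 := by linarith
    _ ≤ (n * L) * (n * L) ^ 2 := by gcongr
    _ = (n * L) ^ 3 := by ring

theorem pow_lt_of_numRescalings_le {n T : ℕ} {L : ℝ} (hn : 2 ≤ n) (hL : 1 ≤ L)
    (hT : 5 * (n : ℝ) * Real.logb 2 (n * L) ≤ T) : ((n * L) ^ 3) ^ n < (8 / 5 : ℝ) ^ T := by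
  have hnR : (2 : ℝ) ≤ n := by exact_mod_cast hn
  have hX : 2 ≤ n * L := by nlinarith
  have hlog : 0 < Real.log (n * L) := Real.log_pos (by linarith)
  have hlog2 : 0 < Real.log 2 := Real.log_pos (by norm_num)
  have h1 : 3 * Real.log 2 < 5 * Real.log (8 / 5) := by
    have := Real.log_lt_log (by norm_num) (by norm_num : (2 : ℝ) ^ 3 < (8 / 5) ^ 5)
    rw [Real.log_pow, Real.log_pow] at this
    exact_mod_cast this
  have h85 : 0 < Real.log (8 / 5) := Real.log_pos (by norm_num)
  rw [← Real.log_lt_log_iff (by positivity) (by positivity), Real.log_pow, Real.log_pow,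
    Real.log_pow]
  rw [Real.logb] at hT
  calc (n : ℝ) * (((3 : ℕ) : ℝ) * Real.log (n * L))
      = n * (Real.log (n * L) / Real.log 2) * (3 * Real.log 2) := by
        push_cast
        field_simp
    _ < n * (Real.log (n * L) / Real.log 2) * (5 * Real.log (8 / 5)) := by
        gcongr
    _ = 5 * n * (Real.log (n * L) / Real.log 2) * Real.log (8 / 5) := by ring
    _ ≤ T * Real.log (8 / 5) := by gcongr

/-- The algorithm terminates, and it returns a minimizer if the number of rounds is large enough. -/
theorem rescalingSFM_spec [Nonempty V] {f : Finset V → ℤ} (hs : IsSubmodular f) (hf : f ∅ = 0)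
    (ch : Choices V) {T : ℕ}
    (hT : 5 * (Fintype.card V : ℝ) * Real.logb 2 (Fintype.card V * maxNorm f) ≤ T) :
    ∃ W, (rescalingSFM f ch T (400 * Fintype.card V ^ 2)).val = some W ∧ ∀ S, f W ≤ f S := by
  have key : ∀ μ W, IsValid f μ W → ∃ W',
      (mainLoop f ch (400 * Fintype.card V ^ 2) (1 / (20 * (Fintype.card V : ℝ))) T 1 μ W 1 1).val
        = some W' ∧ ∀ S, f W' ≤ f S := by
    intro μ W hW
    obtain ⟨W', h1, h2⟩ := mainLoop_spec hs hf ch rfl T 1 μ W 1 hW PosDef.one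
    rw [inv_one] at h1
    refine ⟨W', h1, ?_⟩
    rcases h2 with h2 | ⟨μ', R', -, h3, h4, h5, h6⟩
    · exact h2
    · by_contra! hcon
      obtain ⟨S, hS⟩ := hcon
      simp only [one_mulVec] at h6
      obtain ⟨e1, e2, e3⟩ := det_le_of_not_minimal hs hf h3 hS h4 h6
      have e4 := pow_lt_of_numRescalings_le e1 e2 hT
      rw [det_one, mul_one] at h5
      linarith
  simp only [rescalingSFM, val_bind, val_identity, val_mul, val_div, val_query, val_ite, val_lt,
    val_sub]
  split_ifs with h
  · exact key _ _ ⟨by linarith, by linarith, by ring⟩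
  · exact key _ _ ⟨le_rfl, by linarith, by simp [hf]⟩

end MainLoop

namespace Timed

section Costs

variable {α β : Type}

/-- Bounds on the number of oracle calls and of elementary operations of a computation. -/
structure Within (x : Timed α) (c o : ℕ) : Prop where
  calls_le : x.calls ≤ c
  ops_le : x.ops ≤ o

theorem Within.mono {x : Timed α} {c o c' o' : ℕ} (h : Within x c o) (hc : c ≤ c') (ho : o ≤ o') :
    Within x c' o' := ⟨h.1.trans hc, h.2.trans ho⟩

theorem Within.bind {x : Timed α} {g : α → Timed β} {c o c' o' : ℕ} (h : Within x c o)
    (hg : Within (g x.val) c' o') : Within (x >>= g) (c + c') (o + o') :=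
  ⟨add_le_add h.1 hg.1, add_le_add h.2 hg.2⟩

theorem Within.ite {p : Prop} [Decidable p] {x y : Timed α} {c o : ℕ} (hx : Within x c o)
    (hy : Within y c o) : Within (if p then x else y) c o := by
  split_ifs <;> assumption

theorem within_pure (a : α) : Within (pure a : Timed α) 0 0 := ⟨le_rfl, le_rfl⟩
theorem within_charge (k : ℕ) : Within (charge k) 0 k := ⟨le_rfl, le_rfl⟩
theorem within_query {V : Type} (f : Finset V → ℤ) (S : Finset V) : Within (query f S) 1 0 :=
  ⟨le_rfl, le_rfl⟩
theorem within_add (a b : ℝ) : Within (add a b) 0 1 := ⟨le_rfl, le_rfl⟩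
theorem within_sub (a b : ℝ) : Within (sub a b) 0 1 := ⟨le_rfl, le_rfl⟩
theorem within_mul (a b : ℝ) : Within (mul a b) 0 1 := ⟨le_rfl, le_rfl⟩
theorem within_div (a b : ℝ) : Within (div a b) 0 1 := ⟨le_rfl, le_rfl⟩
theorem within_sqrt (a : ℝ) : Within (sqrt a) 0 1 := ⟨le_rfl, le_rfl⟩
theorem within_abs (a : ℝ) : Within (abs a) 0 1 := ⟨le_rfl, le_rfl⟩
theorem within_lt (a b : ℝ) : Within (lt a b) 0 1 := ⟨le_rfl, le_rfl⟩
theorem within_le (a b : ℝ) : Within (le a b) 0 1 := ⟨le_rfl, le_rfl⟩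

variable {V : Type} [Fintype V] [DecidableEq V]

theorem within_vec {g : V → Timed ℝ} {c k : ℕ} (h : ∀ v, Within (g v) c k) :
    Within (vec g) (Fintype.card V * c) (Fintype.card V * (k + 1)) := by
  constructor
  · refine (Finset.sum_le_sum fun v _ => (h v).1).trans ?_
    simp
  · refine (Finset.sum_le_sum fun v _ => Nat.succ_le_succ (h v).2).trans ?_
    simp

theorem within_sum {g : V → Timed ℝ} {c k : ℕ} (h : ∀ v, Within (g v) c k) :
    Within (sum g) (Fintype.card V * c) (Fintype.card V * (k + 1)) :=
  ⟨(within_vec h).1, (within_vec h).2⟩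

theorem within_mat {g : V → V → Timed ℝ} {k : ℕ} (h : ∀ u v, Within (g u v) 0 k) :
    Within (mat g) 0 (Fintype.card V ^ 2 * (k + 1)) := by
  constructor
  · refine (Finset.sum_le_sum fun u _ => (within_vec (h u)).1).trans ?_
    simp
  · refine (Finset.sum_le_sum fun u _ => (within_vec (h u)).2).trans ?_
    simp [sq, mul_assoc]

theorem within_dot (x y : V → ℝ) : Within (dot x y) 0 (2 * Fintype.card V) :=
  Within.mono (within_sum fun v => within_mul (x v) (y v)) (by simp) (by omega)

theorem within_mulVec (Q : Matrix V V ℝ) (y : V → ℝ) :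
    Within (mulVec Q y) 0 (3 * Fintype.card V ^ 2) :=
  Within.mono (within_vec fun u => within_dot (Q u) y) (by simp) (by nlinarith)

variable [Nonempty V]

theorem within_innerQ (Q : Matrix V V ℝ) (x y : V → ℝ) :
    Within (innerQ Q x y) 0 (5 * Fintype.card V ^ 2) := by
  have hn := Fintype.card_pos (α := V)
  exact Within.mono (Within.bind (within_mulVec Q y) (within_dot x _)) (by simp) (by nlinarith)

theorem within_normQ (Q : Matrix V V ℝ) (x : V → ℝ) :
    Within (normQ Q x) 0 (6 * Fintype.card V ^ 2) := by
  have hn := Fintype.card_pos (α := V)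
  exact Within.mono (Within.bind (within_innerQ Q x x) (within_sqrt _)) (by simp) (by nlinarith)

theorem within_normalize (Q : Matrix V V ℝ) (x : V → ℝ) :
    Within (normalize Q x) 0 (8 * Fintype.card V ^ 2) := by
  have hn := Fintype.card_pos (α := V)
  exact Within.mono (Within.bind (within_normQ Q x)
      (within_vec fun v => within_div (x v) _)) (by simp)
    (by nlinarith)

theorem within_isZero (y : V → ℝ) : Within (isZero y) 0 (Fintype.card V) := ⟨le_rfl, le_rfl⟩

theorem within_pivot (R B : Matrix V V ℝ) (j : V) :
    Within (pivot R B j) 0 (8 * Fintype.card V ^ 2) := by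
  have hn := Fintype.card_pos (α := V)
  exact Within.mono (Within.bind (within_mulVec B _) (Within.bind
      (within_vec fun v => within_div (B j v) _)
    (within_mat fun u v => Within.ite (Within.mono (within_pure _) (Nat.zero_le _) (Nat.zero_le _))
      (Within.bind (within_mul _ _) (within_sub _ _))))) (by simp) (by nlinarith)

theorem within_pivots (R : Matrix V V ℝ) : ∀ (l : List V) (B : Matrix V V ℝ),
    Within (pivots R l B) 0 (l.length * (8 * Fintype.card V ^ 2))
  | [], _ => Within.mono (within_pure _) le_rfl (by simp)
  | j :: l, B => Within.mono (Within.bind (within_pivot R B j) (within_pivots R l _)) (by simp) (by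
      rw [List.length_cons]; linarith)

theorem within_identity : Within (identity : Timed (Matrix V V ℝ)) 0 (Fintype.card V ^ 2) :=
  Within.mono (within_mat fun _ _ => within_pure _) le_rfl (by simp)

theorem within_inverse (R : Matrix V V ℝ) :
    Within (inverse R) 0 (9 * Fintype.card V ^ 3) := by
  have hn := Fintype.card_pos (α := V)
  refine Within.mono (within_identity.bind (within_pivots R _ _)) (by simp) ?_
  rw [Finset.length_toList, Finset.card_univ]
  nlinarith [pow_pos hn 2, pow_pos hn 3]

end Costs

end Timed

section AlgorithmCosts

variable {V : Type} [Fintype V] [DecidableEq V]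

theorem within_evalSlide (f : Finset V → ℤ) (μ : ℝ) (S : Finset V) :
    Within (evalSlide f μ S) 1 (2 * Fintype.card V + 1) :=
  Within.mono (Within.bind (within_charge _) (Within.ite (Within.mono
    (within_pure _) (Nat.zero_le _) (Nat.zero_le _))
    (Within.bind (within_query f S) (within_add _ _)))) (by simp) (by simp)

theorem within_insertBy (w : V → ℝ) (v : V) :
    ∀ l : List V, Within (insertBy w v l) 0 (2 * l.length + 1)
  | [] => Within.mono (Within.bind (within_charge 1) (within_pure _)) (by simp) (by simp)
  | u :: l => Within.mono (Within.bind (within_charge 1) (Within.bind (within_le _ _)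
      (Within.ite (Within.mono (within_pure _) (Nat.zero_le _) (Nat.zero_le _))
        (Within.bind (within_insertBy w v l) (within_pure _))))) (by simp) (by
          rw [List.length_cons]; omega)

theorem within_sortBy (w : V → ℝ) : ∀ l : List V, Within (sortBy w l) 0 (l.length ^ 2)
  | [] => within_pure _
  | v :: l => by
    have h := Within.bind (within_sortBy w l) (within_insertBy w v _)
    rw [(sortBy_perm w l).length_eq] at h
    exact h.mono (by simp) (by rw [List.length_cons]; nlinarith)

theorem within_greedyAux (f : Finset V → ℤ) (μ : ℝ) :
    ∀ (l : List V) (P : Finset V) (p : ℝ) (x : V → ℝ),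
      Within (greedyAux f μ l P p x) l.length (l.length * (2 * Fintype.card V + 4))
  | [], _, _, _ => Within.mono (within_pure _) (by simp) (by simp)
  | v :: l, P, p, x => Within.mono (Within.bind (within_charge 2) (Within.bind
        (within_evalSlide f μ _)
      (Within.bind (within_sub _ _) (within_greedyAux f μ l _ _ _))))
        (by rw [List.length_cons]; omega) (by rw [List.length_cons]; linarith)

theorem within_minPrefixAux (f : Finset V → ℤ) (μ : ℝ) (prefer : Finset V → Bool) :
    ∀ (l : List V) (P S : Finset V) (m : ℝ),
      Within (minPrefixAux f μ prefer l P S m) l.length (l.length * (2 * Fintype.card V + 4))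
  | [], _, _, _ => Within.mono (within_pure _) (by simp) (by simp)
  | v :: l, P, S, m => by
    have h : ∀ (x : Timed Bool) (q : ℝ), Within x 0 1 →
        Within (x >>= fun b =>
          if b = true then minPrefixAux f μ prefer l (insert v P) (insert v P) q
          else minPrefixAux f μ prefer l (insert v P) S m)
          (0 + l.length) (1 + l.length * (2 * Fintype.card V + 4)) := fun x q hx =>
      Within.bind hx (Within.ite (within_minPrefixAux f μ prefer l _ _ _)
        (within_minPrefixAux f μ prefer l _ _ _))
    refine Within.mono (Within.bind (within_charge 2) (Within.bind (within_evalSlide f μ _)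
      (Within.ite (h _ _ (within_le _ _)) (h _ _ (within_lt _ _))))) ?_ ?_
    · rw [List.length_cons]
      omega
    · rw [List.length_cons]
      linarith

theorem within_minPrefix (f : Finset V → ℤ) (μ : ℝ) (prefer : Finset V → Bool) :
    ∀ l : List V,
      Within (minPrefix f μ prefer l) l.length (l.length * (2 * Fintype.card V + 4))
  | [] => Within.mono (within_pure _) (by simp) (by simp)
  | v :: l => Within.mono (Within.bind (within_charge 2) (Within.bind (within_evalSlide f μ _)
      (within_minPrefixAux f μ prefer l _ _ _)))
        (by rw [List.length_cons]; omega) (by rw [List.length_cons]; linarith)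

theorem within_scaleCoeffs (c : ℝ) :
    ∀ l : List (ℝ × (V → ℝ)), Within (scaleCoeffs c l) 0 l.length
  | [] => within_pure _
  | p :: l => Within.mono (Within.bind (within_mul _ _) (Within.bind
        (within_scaleCoeffs c l) (within_pure _)))
      (by simp) (by rw [List.length_cons]; omega)

theorem within_slideBase (l : List V) (δ : ℝ) (g : V → ℝ) :
    Within (slideBase l δ g) 0 (Fintype.card V + 2) := by
  unfold slideBase
  split
  · exact Within.mono (Within.bind (within_charge _) (Within.bind (within_add _ _)
      (Within.bind (within_sub _ _) (within_pure _)))) (by simp) (by simp)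
  · exact Within.mono (within_pure _) le_rfl (Nat.zero_le _)

variable [Nonempty V]

theorem within_extremeBase (f : Finset V → ℤ) (μ : ℝ) {l : List V}
    (hl : l.length = Fintype.card V) :
    Within (extremeBase f μ l) (Fintype.card V) (6 * Fintype.card V ^ 2) := by
  have hn := Fintype.card_pos (α := V)
  exact Within.mono (within_greedyAux f μ l ∅ 0 0) hl.le (by rw [hl]; nlinarith)

theorem within_nextBase (f : Finset V → ℤ) {order : List V}
    (ho : order.length = Fintype.card V) (prefer : Finset V → Bool) (Q : Matrix V V ℝ)
    (s : VNState V) :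
    Within (nextBase f order prefer Q s) (4 * Fintype.card V) (30 * Fintype.card V ^ 2) := by
  have hn := Fintype.card_pos (α := V)
  have hl := ((sortBy_perm (Timed.mulVec Q s.y).val order).length_eq).trans ho
  have hmin := within_minPrefix f s.μ prefer (sortBy (Timed.mulVec Q s.y).val order).val
  have hsort := within_sortBy (Timed.mulVec Q s.y).val order
  rw [hl] at hmin
  rw [ho] at hsort
  refine Within.mono (Within.bind (within_mulVec Q s.y) (hsort.bind
    (Within.bind (within_extremeBase f s.μ hl) (Within.bind (within_dot _ _) (Within.bind
    (within_lt _ _)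
      (Within.ite (c := 2 * Fintype.card V + 1) (o := 15 * Fintype.card V ^ 2)
        (Within.mono (hmin.bind (Within.bind (within_evalSlide _ _ _) (Within.bind (within_sub _ _)
          (Within.bind (within_query _ _) (Within.bind (within_sub _ _) (Within.bind
          (within_slideBase _ _ _)
            (within_pure _))))))) ?_ ?_)
        (Within.mono (within_pure _) (Nat.zero_le _) (Nat.zero_le _)))))))) ?_ ?_
  · omega
  · nlinarith
  · omega
  · nlinarith

theorem within_vnStep (f : Finset V → ℤ) {order : List V}
    (ho : order.length = Fintype.card V) (prefer : Finset V → Bool) (Q : Matrix V V ℝ)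
    (s : VNState V) :
    Within (vnStep f order prefer Q s) (4 * Fintype.card V)
      (60 * Fintype.card V ^ 2 + s.gs.length) := by
  have hn := Fintype.card_pos (α := V)
  refine Within.mono (Within.bind (within_nextBase f ho prefer Q s) (Within.bind
      (within_normalize Q _)
    (Within.bind (within_vec fun v => within_sub _ _) (Within.bind (within_innerQ Q _ _)
    (Within.bind (within_innerQ Q _ _) (Within.bind (within_div _ _) (Within.bind (within_sub _ _)
    (Within.bind (within_vec fun v => Within.bind (within_mul _ _) (Within.bind
    (within_mul _ _) (within_add _ _)))
    (Within.bind (within_scaleCoeffs _ _) (Within.bind (within_charge 1)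
    (within_pure _))))))))))) ?_ ?_
  · omega
  · nlinarith

theorem length_vnStep (f : Finset V → ℤ) (order : List V) (prefer : Finset V → Bool)
    (Q : Matrix V V ℝ) (s : VNState V) :
    (vnStep f order prefer Q s).val.gs.length = s.gs.length + 1 := by
  simp [vnStep]

theorem within_vnLoop (f : Finset V → ℤ) {order : ℕ → List V}
    (ho : ∀ k, (order k).length = Fintype.card V) (prefer : ℕ → Finset V → Bool)
    (Q : Matrix V V ℝ) (ε : ℝ) : ∀ (N k : ℕ) (s : VNState V),
      Within (vnLoop f order prefer Q ε N k s) (N * (4 * Fintype.card V))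
        (N * (70 * Fintype.card V ^ 2 + s.gs.length + N))
  | 0, _, _ => Within.mono (within_pure _) (Nat.zero_le _) (Nat.zero_le _)
  | N + 1, k, s => by
    have hn := Fintype.card_pos (α := V)
    have h := within_vnLoop f ho prefer Q ε N (k + 1) (vnStep f (order k) (prefer k) Q s).val
    rw [length_vnStep] at h
    refine Within.mono (Within.bind (within_charge 1) (Within.bind (within_normQ Q _)
        (Within.bind (within_lt _ _)
      (Within.ite (Within.bind (within_vnStep f (ho k) (prefer k) Q s) h)
        (Within.mono (within_pure _) (Nat.zero_le _) (Nat.zero_le _)))))) ?_ ?_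
    · linarith
    · nlinarith

theorem length_vnLoop_le (f : Finset V → ℤ) (order : ℕ → List V) (prefer : ℕ → Finset V → Bool)
    (Q : Matrix V V ℝ) (ε : ℝ) : ∀ (N k : ℕ) (s s' : VNState V),
      (vnLoop f order prefer Q ε N k s).val = some s' → s'.gs.length + 1 ≤ s.gs.length + N
  | 0, _, _, _, h => by simp [vnLoop] at h
  | N + 1, k, s, s', h => by
    simp only [vnLoop, val_bind, val_ite, val_lt, val_pure] at h
    split_ifs at h with hlt
    · have := length_vnLoop_le f order prefer Q ε N _ _ _ h
      rw [length_vnStep] at this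
      omega
    · rw [← Option.some.inj h]
      omega

theorem within_slidingVonNeumann (f : Finset V → ℤ) {order : ℕ → List V}
    (ho : ∀ k, (order k).length = Fintype.card V) (prefer : ℕ → Finset V → Bool) (μ : ℝ)
    (W : Finset V) (Q : Matrix V V ℝ) (ε : ℝ) :
    Within (slidingVonNeumann f order prefer (400 * Fintype.card V ^ 2) μ W Q ε)
      (1601 * Fintype.card V ^ 3) (190000 * Fintype.card V ^ 4) := by
  have hn := Fintype.card_pos (α := V)
  have h2 := Nat.pow_le_pow_right hn (show 2 ≤ 4 by norm_num)
  refine Within.mono (Within.bind (within_extremeBase f μ (ho 0)) (Within.bind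
      (within_normalize Q _)
    (within_vnLoop f ho prefer Q ε _ 1 _))) ?_ ?_
  · have := Nat.le_self_pow (show 3 ≠ 0 by norm_num) (Fintype.card V)
    nlinarith
  · simp only [List.length_singleton]
    nlinarith

theorem length_slidingVonNeumann_le (f : Finset V → ℤ) (order : ℕ → List V)
    (prefer : ℕ → Finset V → Bool) (N : ℕ) (μ : ℝ) (W : Finset V) (Q : Matrix V V ℝ) (ε : ℝ)
    {s : VNState V} (h : (slidingVonNeumann f order prefer N μ W Q ε).val = some s) :
    s.gs.length ≤ N := by
  have := length_vnLoop_le f order prefer Q ε N _ _ _ h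
  simp only [List.length_singleton] at this
  omega

theorem within_addOuter (Q : Matrix V V ℝ) : ∀ (gs : List (ℝ × (V → ℝ))) (A : Matrix V V ℝ),
    Within (addOuter Q gs A) 0 (gs.length * (10 * Fintype.card V ^ 2))
  | [], _ => Within.mono (within_pure _) le_rfl (by simp)
  | p :: l, A => by
    have hn := Fintype.card_pos (α := V)
    refine Within.mono (Within.bind (within_innerQ Q _ _) (Within.bind (within_div _ _)
      (Within.bind (within_mat (k := 3) fun u v => Within.mono (Within.bind (within_mul _ _)
        (Within.bind (within_mul _ _) (within_add _ _))) (by simp) (by simp))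
        (within_addOuter Q l _)))) (by simp) ?_
    rw [List.length_cons]
    nlinarith

theorem within_rescale (Q R : Matrix V V ℝ) (ε : ℝ) (gs : List (ℝ × (V → ℝ))) :
    Within (rescale Q R ε gs) 0 (gs.length * (10 * Fintype.card V ^ 2)
      + 4 * Fintype.card V ^ 2) := by
  have hn := Fintype.card_pos (α := V)
  exact Within.mono (Within.bind (within_addOuter Q gs R) (Within.bind (within_add _ _)
      (Within.bind (within_mul _ _)
    (within_mat fun u v => within_div _ _)))) (by simp) (by nlinarith)

theorem within_mainLoop (f : Finset V → ℤ) (ch : Choices V) (ε : ℝ) :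
    ∀ (T i : ℕ) (μ : ℝ) (W : Finset V) (Q R : Matrix V V ℝ),
      Within (mainLoop f ch (400 * Fintype.card V ^ 2) ε T i μ W Q R)
        (T * (1601 * Fintype.card V ^ 3)) (T * (195000 * Fintype.card V ^ 4))
  | 0, _, _, _, _, _ => Within.mono (within_pure _) (Nat.zero_le _) (Nat.zero_le _)
  | T + 1, i, μ, W, Q, R => by
    have hn := Fintype.card_pos (α := V)
    have h0 := Nat.one_le_pow 4 _ hn
    have h1 := Nat.le_self_pow (show 4 ≠ 0 by norm_num) (Fintype.card V)
    have h2 := Nat.pow_le_pow_right hn (show 2 ≤ 4 by norm_num)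
    have h3 := Nat.pow_le_pow_right hn (show 3 ≤ 4 by norm_num)
    have hsvn := within_slidingVonNeumann f
      (fun k => length_of_forall_mem (ch.order_nodup i k) (ch.mem_order i k)) (ch.prefer i) μ W Q ε
    rw [mainLoop]
    refine Within.mono (Within.bind
        (within_charge 1) (hsvn.bind (c' := T * (1601 * Fintype.card V ^ 3))
      (o' := T * (195000 * Fintype.card V ^ 4) + 4999 * Fintype.card V ^ 4) ?_)) ?_ ?_
    · cases hval : (slidingVonNeumann f (ch.order i) (ch.prefer i) (400 * Fintype.card V ^ 2)
        μ W Q ε).val with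
      | none => exact Within.mono (within_pure _) (Nat.zero_le _) (Nat.zero_le _)
      | some s =>
        have hlen := length_slidingVonNeumann_le _ _ _ _ _ _ _ _ hval
        refine Within.mono (Within.bind (within_isZero s.y) (Within.ite
          (Within.mono (within_pure _) (Nat.zero_le _) (Nat.zero_le _))
          (Within.bind (within_rescale Q R ε s.gs) (Within.bind (within_inverse _)
            (within_mainLoop f ch ε T (i + 1) _ _ _ _))))) (by simp) ?_
        have h4 : s.gs.length * (10 * Fintype.card V ^ 2) ≤ 4000 * Fintype.card V ^ 4 :=
          (Nat.mul_le_mul_right _ hlen).trans_eq (by ring)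
        linarith
    · linarith
    · linarith

theorem within_rescalingSFM (f : Finset V → ℤ) (ch : Choices V) (T : ℕ) :
    Within (rescalingSFM f ch T (400 * Fintype.card V ^ 2))
      (1 + T * (1601 * Fintype.card V ^ 3))
      (7 * Fintype.card V ^ 2 + T * (195000 * Fintype.card V ^ 4)) := by
  have hn := Fintype.card_pos (α := V)
  have h1 := Nat.le_self_pow (show 2 ≠ 0 by norm_num) (Fintype.card V)
  refine Within.mono (within_identity.bind (within_identity.bind (Within.bind
      (within_mul _ _) (Within.bind (within_div _ _)
    (Within.bind (within_query _ _) (Within.bind (within_charge _) (Within.bind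
    (within_lt _ _) (Within.ite
      (Within.bind (within_sub _ _) (within_mainLoop f ch _ T 1 _ _ _ _))
      (Within.mono (within_mainLoop f ch _ T 1 _ _ _ _) (by simp) (by simp)))))))))) ?_ ?_
  · linarith
  · nlinarith

theorem within_alphaNorm (f : Finset V → ℤ) :
    Within (alphaNorm f) (1 + 2 * Fintype.card V) (10 * Fintype.card V ^ 2) := by
  have hn := Fintype.card_pos (α := V)
  refine Within.mono (Within.bind (within_query _ _) (Within.bind
      (within_vec fun v => Within.bind (within_charge _)
    (Within.bind (within_query _ _) (Within.bind (within_query _ _) (Within.bind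
    (within_abs _) (Within.bind (within_sub _ _)
      (Within.bind (within_abs _) (Within.bind (within_lt _ _) (Within.ite (within_pure _)
      (within_pure _)))))))))
        (Within.bind (within_dot _ _) (within_sqrt _)))) ?_ ?_
  · omega
  · nlinarith

theorem val_alphaNorm (f : Finset V → ℤ) : (alphaNorm f).val = norm2 (alpha f) := by
  simp only [alphaNorm, val_bind, val_sqrt, val_dot, val_vec, norm2, dotProduct]
  congr 1
  refine Finset.sum_congr rfl fun v _ => ?_
  simp only [val_query, val_abs, val_sub, val_ite, val_lt, val_pure, sq, alpha]
  split_ifs with h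
  · rw [max_eq_right h.le]
  · rw [max_eq_left (not_lt.1 h)]

end AlgorithmCosts

section Complexity

variable {V : Type} [Fintype V] [DecidableEq V]

theorem numRescalings_le {n : ℕ} (hn : 0 < n) {Z l : ℝ} (hl : 1 ≤ l)
    (hZ : Real.logb 2 (n * Z) ≤ 2 * l) : (numRescalings n Z : ℝ) ≤ 11 * n * l := by
  have hn' : (1 : ℝ) ≤ n := by exact_mod_cast hn
  have h1 : numRescalings n Z ≤ ⌈10 * (n : ℝ) * l⌉₊ := Nat.ceil_mono (by nlinarith)
  have h2 := (Nat.ceil_lt_add_one (by positivity : (0 : ℝ) ≤ 10 * n * l)).le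
  have h3 : (numRescalings n Z : ℝ) ≤ ⌈10 * (n : ℝ) * l⌉₊ := by exact_mod_cast h1
  nlinarith

theorem Timed.Within.time_le {α : Type} {x : Timed α} {n T : ℕ} (hn : 0 < n)
    (h : Within x (4 * n + T * (1601 * n ^ 3)) (21 * n ^ 2 + T * (195000 * n ^ 4)))
    {l EO : ℝ} (hl : 1 ≤ l) (hT : (T : ℝ) ≤ 11 * n * l) (hEO : 0 ≤ EO) :
    x.time EO ≤ 3000000 * ((n : ℝ) ^ 4 * EO + (n : ℝ) ^ 5) * l := by
  have hn' : (1 : ℝ) ≤ n := by exact_mod_cast hn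
  have h1 : (x.calls : ℝ) ≤ 4 * n + T * (1601 * n ^ 3) := by exact_mod_cast h.1
  have h2 : (x.ops : ℝ) ≤ 21 * n ^ 2 + T * (195000 * n ^ 4) := by exact_mod_cast h.2
  have e1 : (n : ℝ) ≤ n ^ 4 := le_self_pow₀ hn' (by norm_num)
  have e2 : (n : ℝ) ^ 2 ≤ n ^ 5 := pow_le_pow_right₀ hn' (by norm_num)
  have e3 : (n : ℝ) ^ 4 ≤ n ^ 4 * l := le_mul_of_one_le_right (by positivity) hl
  have e4 : (n : ℝ) ^ 5 ≤ n ^ 5 * l := le_mul_of_one_le_right (by positivity) hl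
  have h3 : (x.calls : ℝ) ≤ 3000000 * (n ^ 4 * l) := by
    have : (T : ℝ) * (1601 * n ^ 3) ≤ 11 * n * l * (1601 * n ^ 3) := by gcongr
    nlinarith
  have h4 : (x.ops : ℝ) ≤ 3000000 * (n ^ 5 * l) := by
    have : (T : ℝ) * (195000 * n ^ 4) ≤ 11 * n * l * (195000 * n ^ 4) := by gcongr
    nlinarith
  have h5 := mul_le_mul_of_nonneg_right h3 hEO
  rw [Timed.time]
  linarith

theorem one_le_logb_max (x : ℝ) : 1 ≤ Real.logb 2 (max 2 x) := by
  rw [Real.le_logb_iff_rpow_le (by norm_num) (by positivity), Real.rpow_one]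
  exact le_max_left _ _

theorem logb_le_logb_max {x : ℝ} (hx : 0 ≤ x) : Real.logb 2 x ≤ Real.logb 2 (max 2 x) := by
  rcases hx.eq_or_lt with rfl | hx
  · rw [Real.logb_zero]
    linarith [one_le_logb_max 0]
  · exact Real.logb_le_logb_of_le (by norm_num) hx (le_max_right _ _)

theorem logb_alpha_le [Nonempty V] {f : Finset V → ℤ} (hs : IsSubmodular f) (hf : f ∅ = 0) :
    Real.logb 2 (Fintype.card V * norm2 (alpha f))
      ≤ 2 * Real.logb 2 (max 2 (Fintype.card V * maxNorm f)) := by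
  have hn : (1 : ℝ) ≤ Fintype.card V := by exact_mod_cast Fintype.card_pos (α := V)
  have hΛ := one_le_logb_max (Fintype.card V * maxNorm f)
  by_cases hL : 1 ≤ maxNorm f
  · have hα := norm2_alpha_le hs hf
    have hpos : 0 < norm2 (alpha f) := by linarith [maxNorm_le_norm2_alpha f]
    have hsq : √(Fintype.card V : ℝ) ≤ Fintype.card V := by
      rw [Real.sqrt_le_left (by linarith)]
      nlinarith
    have h1 : Fintype.card V * norm2 (alpha f) ≤ (Fintype.card V * maxNorm f) ^ 2 := by
      calc Fintype.card V * norm2 (alpha f)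
          ≤ Fintype.card V * (Fintype.card V * maxNorm f) := by
            gcongr
            exact hα.trans (by gcongr)
        _ ≤ Fintype.card V * (Fintype.card V * maxNorm f) * maxNorm f :=
            le_mul_of_one_le_right (by positivity) hL
        _ = _ := by ring
    calc Real.logb 2 (Fintype.card V * norm2 (alpha f))
        ≤ Real.logb 2 ((Fintype.card V * maxNorm f) ^ 2) :=
          Real.logb_le_logb_of_le (by norm_num) (by positivity) h1
      _ = 2 * Real.logb 2 (Fintype.card V * maxNorm f) := by
          rw [Real.logb_pow]
          norm_num
      _ ≤ _ := by
          have := logb_le_logb_max (x := Fintype.card V * maxNorm f) (by positivity)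
          linarith
  · have h0 : norm2 (alpha f) = 0 := by
      simp [norm2, alpha_eq_zero hs hf (not_le.1 hL)]
    rw [h0, mul_zero, Real.logb_zero]
    linarith

theorem logb_maxNorm_le [Nonempty V] (f : Finset V → ℤ) :
    5 * (Fintype.card V : ℝ) * Real.logb 2 (Fintype.card V * maxNorm f)
      ≤ numRescalings (Fintype.card V) (norm2 (alpha f)) := by
  have hn : (1 : ℝ) ≤ Fintype.card V := by exact_mod_cast Fintype.card_pos (α := V)
  rcases (maxNorm_nonneg f).eq_or_lt with h | h
  · rw [← h, mul_zero, Real.logb_zero, mul_zero]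
    exact Nat.cast_nonneg _
  · refine le_trans ?_ (Nat.le_ceil _)
    gcongr
    · norm_num
    · exact maxNorm_le_norm2_alpha f

end Complexity

end SFM

theorem theorem3p1 :
    ∃ C : ℝ, ∀ (V : Type) [Fintype V] [DecidableEq V] [Nonempty V] (f : Finset V → ℤ)
      (ch : SFM.Choices V), SFM.IsSubmodular f → f ∅ = 0 →
      (∃ (N : ℕ) (W : Finset V),
        (SFM.rescalingSFM f ch
          (SFM.numRescalings (Fintype.card V) (SFM.maxNorm f)) N).val = some W ∧
        (∀ S : Finset V, f W ≤ f S) ∧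
        ∀ EO : ℝ, 0 ≤ EO →
          (SFM.rescalingSFM f ch
            (SFM.numRescalings (Fintype.card V) (SFM.maxNorm f)) N).time EO ≤
          C * ((Fintype.card V : ℝ) ^ 4 * EO + (Fintype.card V : ℝ) ^ 5) *
            Real.logb 2 (max 2 ((Fintype.card V : ℝ) * SFM.maxNorm f))) ∧
      (∃ (N : ℕ) (W : Finset V),
        (SFM.rescalingSFMAlpha f ch N).val = some W ∧
        (∀ S : Finset V, f W ≤ f S) ∧
        ∀ EO : ℝ, 0 ≤ EO →
          (SFM.rescalingSFMAlpha f ch N).time EO ≤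
          C * ((Fintype.card V : ℝ) ^ 4 * EO + (Fintype.card V : ℝ) ^ 5) *
            Real.logb 2 (max 2 ((Fintype.card V : ℝ) * SFM.maxNorm f))) := by
  refine ⟨3000000, fun V _ _ _ f ch hs hf => ⟨?_, ?_⟩⟩
  all_goals
    have hn := Fintype.card_pos (α := V)
    have hn2 := Nat.le_self_pow (show 2 ≠ 0 by norm_num) (Fintype.card V)
    have hL := SFM.maxNorm_nonneg f
    have hl := SFM.one_le_logb_max ((Fintype.card V : ℝ) * SFM.maxNorm f)
  · obtain ⟨W, hval, hmin⟩ := SFM.rescalingSFM_spec hs hf ch (Nat.le_ceil _)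
    refine ⟨_, W, hval, hmin, fun EO hEO => ?_⟩
    refine SFM.Timed.Within.time_le
      (T := SFM.numRescalings (Fintype.card V) (SFM.maxNorm f)) hn
      (SFM.Timed.Within.mono (SFM.within_rescalingSFM f ch _) ?_ ?_) hl
      (SFM.numRescalings_le hn hl ?_) hEO
    · omega
    · omega
    · have := SFM.logb_le_logb_max (x := (Fintype.card V : ℝ) * SFM.maxNorm f) (by positivity)
      linarith
  · obtain ⟨W, hval, hmin⟩ := SFM.rescalingSFM_spec hs hf ch (SFM.logb_maxNorm_le f)
    rw [← SFM.val_alphaNorm] at hval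
    refine ⟨_, W, hval, hmin, fun EO hEO => ?_⟩
    refine SFM.Timed.Within.time_le
      (T := SFM.numRescalings (Fintype.card V) (SFM.alphaNorm f).val) hn
      (SFM.Timed.Within.mono (SFM.Timed.Within.bind (SFM.within_alphaNorm f)
        (SFM.Timed.Within.bind (SFM.Timed.within_charge 4)
          (SFM.within_rescalingSFM f ch _))) ?_ ?_) hl
      (SFM.numRescalings_le hn hl ?_) hEO
    · omega
    · nlinarith
    · rw [SFM.val_alphaNorm]
      exact SFM.logb_alpha_le hs hf
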